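/- Let $X$ be an (integral) projective variety over $\mathbb{C}$ with normalization $\nu:\tilde X\to X$ such that $\tilde X$ is smooth over $\mathbb{C}$. Let $\mathcal F$ be a $\nu_*\mathcal O_{\tilde X}$-module which, regarded as an $\mathcal O_X$-module via $\mathcal O_X\to\nu_*\mathcal O_{\tilde X}$, is coherent and torsion-free. Put $\mathcal E:=\nu^*\mathcal F/\mathrm{Tors}(\nu^*\mathcal F)$, where $\nu^*\mathcal F$ is the pullback of the $\mathcal O_X$-module $\mathcal F$ and $\mathrm{Tors}$ denotes the torsion subsheaf. Then $\mathcal E$ is a coherent sheaf on $\tilde X$, and $\nu_*\mathcal E\cong\mathcal F$ as $\nu_*\mathcal O_{\tilde X}$-modules (hence as $\mathcal O_X$-modules). Moreover, $\mathcal E$ is unique up to isomorphism: if $\mathcal E'$ is any coherent sheaf on $\tilde X$ with $\nu_*\mathcal E'\cong\mathcal F$ as $\mathcal O_X$-modules, then $\mathcal E'\cong\mathcal E$. -/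

import Mathlib

open CategoryTheory AlgebraicGeometry TopologicalSpace Opposite

noncomputable section

namespace NormalizationModules

universe u

/-! ### Complex projective varieties and normalizations -/

attribute [local instance] MvPolynomial.gradedAlgebra in
/-- Complex projective space `ℙⁿ = Proj ℂ[x₀, …, xₙ]`. -/
def projectiveSpace (n : ℕ) : Scheme.{0} :=
  Proj (MvPolynomial.homogeneousSubmodule (Fin (n + 1)) ℂ)

attribute [local instance] MvPolynomial.gradedAlgebra in
/-- The structure morphism `ℙⁿ ⟶ Spec ℂ`. -/
def projectiveSpaceToSpec (n : ℕ) : projectiveSpace n ⟶ Spec (.of ℂ) :=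
  Proj.toSpecZero (MvPolynomial.homogeneousSubmodule (Fin (n + 1)) ℂ) ≫
    Spec.map (CommRingCat.ofHom
      (algebraMap ℂ (MvPolynomial.homogeneousSubmodule (Fin (n + 1)) ℂ 0)))

/-- A scheme over `ℂ` is projective if it is, over `ℂ`, a closed subscheme of some `ℙⁿ`. -/
def IsProjective {X : Scheme.{0}} (s : X ⟶ Spec (.of ℂ)) : Prop :=
  ∃ (n : ℕ) (i : X ⟶ projectiveSpace n), IsClosedImmersion i ∧ i ≫ projectiveSpaceToSpec n = s

/-- `ν : Y ⟶ X` is a normalization of the integral scheme `X`: the scheme `Y` is integral and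
normal, and `ν` is integral and birational. (If `Y` is of finite type over a field, as for
varieties, such a `ν` is automatically finite.) -/
structure IsNormalization {X Y : Scheme.{u}} (ν : Y ⟶ X) : Prop where
  isIntegral : IsIntegral Y
  isIntegrallyClosed_stalk : ∀ y : Y, IsIntegrallyClosed (Y.presheaf.stalk y)
  isIntegralHom : IsIntegralHom ν
  birational : ∃ U : X.Opens, (U : Set X).Nonempty ∧ IsIso (ν ∣_ U)

/-! ### Coherent and torsion-free sheaves of modules -/

/-- Coherent sheaves of modules (on locally Noetherian schemes): quasi-coherent sheaves whose
sections over every affine open `U` form a finitely generated `Γ(X, U)`-module. -/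
structure IsCoherent {X : Scheme.{u}} (M : X.Modules) : Prop where
  isQuasicoherent : M.IsQuasicoherent
  finite : ∀ U : X.Opens, IsAffineOpen U → Module.Finite Γ(X, U) Γ(M, U)

/-- A sheaf of modules on an integral scheme is torsion-free if no nonzero section is annihilated
by a nonzero function. -/
def IsTorsionFree {X : Scheme.{u}} (M : X.Modules) : Prop :=
  ∀ (U : X.Opens) (a : Γ(X, U)) (s : Γ(M, U)), a • s = 0 → a = 0 ∨ s = 0

section Torsion

variable {X : Scheme.{u}} (M : X.Modules)

/-- A section is locally torsion if around every point it is annihilated by a nonzero function;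
on an integral scheme this says that all its germs are torsion. -/
def IsLocallyTorsion {U : X.Opens} (s : Γ(M, U)) : Prop :=
  ∀ x ∈ U, ∃ (V : X.Opens) (h : V ≤ U), x ∈ V ∧
    ∃ a : Γ(X, V), a ≠ 0 ∧ a • M.presheaf.map (homOfLE h).op s = 0

variable {M}

lemma map_map_apply {U V W : X.Opens} (h : V ≤ U) (k : W ≤ V) (s : Γ(M, U)) :
    M.presheaf.map (homOfLE k).op (M.presheaf.map (homOfLE h).op s) =
      M.presheaf.map (homOfLE (k.trans h)).op s := by
  rw [← ConcreteCategory.comp_apply, ← M.presheaf.map_comp]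
  rfl

lemma map_ne_zero [IsIntegral X] {V W : X.Opens} (h : W ≤ V) {x : X} (hx : x ∈ W)
    {a : Γ(X, V)} (ha : a ≠ 0) : X.presheaf.map (homOfLE h).op a ≠ 0 := by
  have : Nonempty W := ⟨⟨x, hx⟩⟩
  have := map_injective_of_isIntegral X (homOfLE h)
  exact fun h0 => ha (this (by simpa using h0))

lemma IsLocallyTorsion.map [IsIntegral X] {U W : X.Opens} (h : W ≤ U) {s : Γ(M, U)}
    (hs : IsLocallyTorsion M s) : IsLocallyTorsion M (M.presheaf.map (homOfLE h).op s) := by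
  intro x hx
  obtain ⟨V, hV, hxV, a, ha, has⟩ := hs x (h hx)
  have hxW : x ∈ V ⊓ W := ⟨hxV, hx⟩
  refine ⟨V ⊓ W, inf_le_right, hxW, X.presheaf.map (homOfLE inf_le_left).op a,
    map_ne_zero _ hxW ha, ?_⟩
  rw [map_map_apply, ← map_map_apply hV inf_le_left, ← Scheme.Modules.map_smul, has, map_zero]

lemma IsLocallyTorsion.add [IsIntegral X] {U : X.Opens} {s t : Γ(M, U)}
    (hs : IsLocallyTorsion M s) (ht : IsLocallyTorsion M t) : IsLocallyTorsion M (s + t) := by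
  intro x hx
  obtain ⟨V, hV, hxV, a, ha, has⟩ := hs x hx
  obtain ⟨W, hW, hxW, b, hb, hbt⟩ := ht x hx
  have hxVW : x ∈ V ⊓ W := ⟨hxV, hxW⟩
  have : Nonempty (V ⊓ W : X.Opens) := ⟨⟨x, hxVW⟩⟩
  refine ⟨V ⊓ W, inf_le_left.trans hV, hxVW,
    X.presheaf.map (homOfLE inf_le_left).op a * X.presheaf.map (homOfLE inf_le_right).op b,
    mul_ne_zero (map_ne_zero _ hxVW ha) (map_ne_zero _ hxVW hb), ?_⟩
  have h1 : X.presheaf.map (homOfLE (inf_le_left : V ⊓ W ≤ V)).op a •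
      M.presheaf.map (homOfLE (inf_le_left.trans hV : V ⊓ W ≤ U)).op s = 0 := by
    rw [← map_map_apply hV inf_le_left, ← Scheme.Modules.map_smul, has, map_zero]
  have h2 : X.presheaf.map (homOfLE (inf_le_right : V ⊓ W ≤ W)).op b •
      M.presheaf.map (homOfLE (inf_le_left.trans hV : V ⊓ W ≤ U)).op t = 0 := by
    rw [← map_map_apply hW inf_le_right, ← Scheme.Modules.map_smul, hbt, map_zero]
  rw [map_add, smul_add, mul_smul, mul_smul, h2, smul_zero, add_zero, smul_comm, h1, smul_zero]

lemma IsLocallyTorsion.zero [IsIntegral X] {U : X.Opens} : IsLocallyTorsion M (0 : Γ(M, U)) := by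
  intro x hx
  have : Nonempty U := ⟨⟨x, hx⟩⟩
  exact ⟨U, le_rfl, hx, 1, one_ne_zero, by rw [map_zero, smul_zero]⟩

lemma IsLocallyTorsion.smul {U : X.Opens} (b : Γ(X, U)) {s : Γ(M, U)}
    (hs : IsLocallyTorsion M s) : IsLocallyTorsion M (b • s) := by
  intro x hx
  obtain ⟨V, hV, hxV, a, ha, has⟩ := hs x hx
  refine ⟨V, hV, hxV, a, ha, ?_⟩
  rw [Scheme.Modules.map_smul, smul_comm, has, smul_zero]

variable (M)

/-- The presheaf of locally torsion sections of `M`, as a submodule of `M`. -/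
def torsionSubmodule [IsIntegral X] : PresheafOfModules.Submodule M.val where
  obj U :=
    { carrier := {s | IsLocallyTorsion M (U := U.unop) s}
      add_mem' := fun hs ht => hs.add ht
      zero_mem' := IsLocallyTorsion.zero
      smul_mem' := fun b _ hs => IsLocallyTorsion.smul (U := U.unop) b hs }
  map {U V} f := fun _ hs => IsLocallyTorsion.map (U := U.unop) (W := V.unop) f.unop.le hs

lemma torsionSubmodule_isSheaf [IsIntegral X] :
    TopCat.Presheaf.IsSheaf (torsionSubmodule M).toPresheafOfModules.presheaf := by
  let P := M.val.presheaf
  have hM : Presheaf.IsSheaf (Opens.grothendieckTopology X) P := M.isSheaf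
  let G : Subfunctor (P ⋙ forget Ab) :=
    { obj := fun U => {s | IsLocallyTorsion M (U := U.unop) s}
      map := fun {U V} f _ hs => IsLocallyTorsion.map (U := U.unop) (W := V.unop) f.unop.le hs }
  rw [TopCat.Presheaf.IsSheaf, Presheaf.isSheaf_iff_isSheaf_forget _ _ (forget Ab)]
  rw [Presheaf.isSheaf_iff_isSheaf_forget _ _ (forget Ab), isSheaf_iff_isSheaf_of_type] at hM
  rw [isSheaf_iff_isSheaf_of_type]
  have hG : Presieve.IsSheaf (Opens.grothendieckTopology X) G.toFunctor := by
    rw [Subfunctor.isSheaf_iff _ hM]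
    intro U s hs x hx
    obtain ⟨W, i, hi, hxW⟩ := hs x hx
    obtain ⟨V, hV, hxV, a, ha, has⟩ := (hi : IsLocallyTorsion M (U := W) _) x hxW
    refine ⟨V, hV.trans i.le, hxV, a, ha, ?_⟩
    have key := map_map_apply (M := M) (U := U.unop) i.le hV s
    exact (congrArg (fun t => a • t) key).symm.trans has
  exact Presieve.isSheaf_iso _ (NatIso.ofComponents (fun U => Iso.refl _) (fun _ => rfl)) hG

/-- The torsion subsheaf of `M`. -/
def torsionSubsheaf [IsIntegral X] : X.Modules where
  val := (torsionSubmodule M).toPresheafOfModules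
  isSheaf := torsionSubmodule_isSheaf M

/-- The inclusion of the torsion subsheaf of `M` into `M`. -/
def torsionι [IsIntegral X] : torsionSubsheaf M ⟶ M where
  val := (torsionSubmodule M).ι

/-- `M` modulo torsion: the quotient sheaf of `M` by its torsion subsheaf. -/
def modTorsion [IsIntegral X] : X.Modules := Limits.cokernel (torsionι M)

end Torsion

/-! ### Modules over the sheaf of rings `ν_* 𝒪_Y` -/

section PushforwardRing

variable {X Y : Scheme.{u}} (ν : Y ⟶ X)

/-- The sheaf of rings `ν_* 𝒪_Y` on `X`, with sections `Γ(Y, ν⁻¹ U)` over `U`. -/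
def pushforwardRing : Sheaf (Opens.grothendieckTopology X) RingCat.{u} :=
  ((Opens.map ν.base).sheafPushforwardContinuous RingCat.{u} _ _).obj Y.ringCatSheaf

/-- Restriction of scalars along `𝒪_X ⟶ ν_* 𝒪_Y`. -/
def restrictToBase : SheafOfModules.{u} (pushforwardRing ν) ⥤ X.Modules :=
  SheafOfModules.restrictScalars ν.toRingCatSheafHom

/-- The pushforward of an `𝒪_Y`-module, as a module over `ν_* 𝒪_Y`. -/
def pushforwardOverRing : Y.Modules ⥤ SheafOfModules.{u} (pushforwardRing ν) :=
  SheafOfModules.pushforward (𝟙 (pushforwardRing ν))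

/-- Forgetting the `ν_* 𝒪_Y`-structure of `ν_* E` gives the usual pushforward. -/
lemma pushforwardOverRing_comp_restrictToBase :
    pushforwardOverRing ν ⋙ restrictToBase ν = Scheme.Modules.pushforward ν := by
  rfl

end PushforwardRing

end NormalizationModules

end

open NormalizationModules

/-! Write `Y` for the normalization. Birationality gives a nonempty open `U₀` of `X` and an open
immersion `k : U₀ ⟶ Y` with `k ≫ ν = U₀.ι`. Hence functions on `Y` have denominators on `X`
(`exists_pullOn_mul_eq`). Call a torsion-free `G` on `Y` a hull of `F` if `F` maps injectively into
`ν_* G` and generates `G` over `𝒪_Y` (`IsTorsionFreeHull`). The theorem follows from four facts.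

Every hull is `ν^* F` modulo torsion (`nonempty_modTorsion_pullback_iso`): the adjoint map `ν^* F ⟶
G` is an epimorphism. After clearing denominators a local section of its kernel comes from a section
of `F` that dies in `G`, hence is zero; so the kernel is torsion.

A hull exists (`isTorsionFreeHull_toGenerated`): take the subsheaf generated by `F` in `k_* (F|U₀)`.

A hull satisfies `ν_* G ≅ F` and is coherent (`IsTorsionFreeHull.exists_pow_smul_eq_secOn`): since
`ν_* 𝒪_Y` already acts on `F`, the `𝒪_Y`-combinations of sections of `F` are nothing new. The work
lies in passing from local combinations to sections over `ν⁻¹ U` for affine `U`; there `ν⁻¹ U` is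
affine because `ν` is integral.

A coherent `E'` with `ν_* E' ≅ F` is itself a hull (`isTorsionFreeHull_of_iso`), which gives
uniqueness. -/

noncomputable section

namespace NormalizationModules

universe u

/-! ### Sections of sheaves of modules, and quasi-coherence as localization on affine opens. -/

section

variable {X : Scheme.{u}}

/-- Restriction of functions, as a ring homomorphism. -/
def resRing {U V : X.Opens} (h : V ≤ U) : Γ(X, U) →+* Γ(X, V) :=
  (X.presheaf.map (homOfLE h).op).hom

/-- Restriction of sections of a sheaf of modules. -/
def res (M : X.Modules) {U V : X.Opens} (h : V ≤ U) : Γ(M, U) →+ Γ(M, V) :=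
  (M.presheaf.map (homOfLE h).op).hom

lemma resRing_resRing {U V W : X.Opens} (h : V ≤ U) (k : W ≤ V) (a : Γ(X, U)) :
    resRing k (resRing h a) = resRing (k.trans h) a := by
  simp only [resRing]
  rw [← CommRingCat.comp_apply, ← X.presheaf.map_comp]
  rfl

lemma resRing_self {U : X.Opens} (a : Γ(X, U)) : resRing le_rfl a = a := by
  change X.presheaf.map (𝟙 _) a = a
  rw [X.presheaf.map_id]; rfl

lemma resRing_injective [IsIntegral X] {U V : X.Opens} (h : V ≤ U) (hV : (V : Set X).Nonempty) :
    Function.Injective (resRing h) := by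
  have : Nonempty V := hV.to_subtype
  exact map_injective_of_isIntegral X (homOfLE h)

variable {M : X.Modules}

lemma res_res {U V W : X.Opens} (h : V ≤ U) (k : W ≤ V) (s : Γ(M, U)) :
    res M k (res M h s) = res M (k.trans h) s :=
  map_map_apply h k s

lemma res_self {U : X.Opens} (s : Γ(M, U)) : res M le_rfl s = s := by
  change M.presheaf.map (𝟙 _) s = s
  rw [M.presheaf.map_id]; rfl

lemma res_smul {U V : X.Opens} (h : V ≤ U) (a : Γ(X, U)) (s : Γ(M, U)) :
    res M h (a • s) = resRing h a • res M h s :=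
  Scheme.Modules.map_smul M (homOfLE h) a s

lemma res_injective_of_le {U V : X.Opens} (h : V ≤ U) (k : U ≤ V) :
    Function.Injective (res M h) := fun s t hst => by
  have := congrArg (res M k) hst
  rwa [res_res, res_res, res_self, res_self] at this

lemma app_res {N : X.Modules} (φ : M ⟶ N) {U V : X.Opens} (h : V ≤ U) (s : Γ(M, U)) :
    φ.app V (res M h s) = res N h (φ.app U s) :=
  ConcreteCategory.congr_hom (φ.mapPresheaf.naturality (homOfLE h).op) s

lemma app_smul {N : X.Modules} (φ : M ⟶ N) {U : X.Opens} (a : Γ(X, U)) (s : Γ(M, U)) :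
    φ.app U (a • s) = a • φ.app U s :=
  Scheme.Modules.Hom.app_smul φ a s

lemma eq_of_locally_eq {U : X.Opens} {s t : Γ(M, U)}
    (h : ∀ x ∈ U, ∃ (V : X.Opens) (k : V ≤ U), x ∈ V ∧ res M k s = res M k t) : s = t := by
  refine TopCat.Presheaf.IsSheaf.section_ext M.isSheaf fun x hx => ?_
  obtain ⟨V, k, hxV, hV⟩ := h x hx
  exact ⟨V, k, hxV, hV⟩

lemma existsUnique_gluing {ι : Type*} (V : ι → X.Opens) {U : X.Opens} (hVU : ∀ i, V i ≤ U)
    (hU : ∀ x ∈ U, ∃ i, x ∈ V i) (s : ∀ i, Γ(M, V i))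
    (hs : ∀ i j, res M inf_le_left (s i) = res M (inf_le_right : V i ⊓ V j ≤ V j) (s j)) :
    ∃ t : Γ(M, U), ∀ i, res M (hVU i) t = s i := by
  obtain ⟨t, ht, -⟩ := TopCat.Sheaf.existsUnique_gluing' ⟨_, M.isSheaf⟩ V U
    (fun i => homOfLE (hVU i)) (fun x hx => by simpa using hU x hx) s (fun i j => hs i j)
  exact ⟨t, ht⟩

lemma appIso_fromSpec_inv_apply {U : X.Opens} (hU : IsAffineOpen U)
    (V : (Spec Γ(X, U)).Opens) (h : hU.fromSpec ''ᵁ V ≤ U) (r : Γ(X, U)) :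
    (hU.fromSpec.appIso V).inv ((Spec Γ(X, U)).presheaf.map V.leTop.op
      ((Scheme.ΓSpecIso Γ(X, U)).inv r)) = resRing h r := by
  have key : (Scheme.ΓSpecIso Γ(X, U)).inv ≫ (Spec Γ(X, U)).presheaf.map V.leTop.op =
      X.presheaf.map (homOfLE h).op ≫ (hU.fromSpec.appIso V).hom := by
    rw [Scheme.Hom.appIso_hom, hU.fromSpec.naturality_assoc, hU.fromSpec_app_self]
    simp only [Category.assoc, ← Functor.map_comp]
    rfl
  have := ConcreteCategory.congr_hom key r
  simp only [ConcreteCategory.comp_apply] at this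
  rw [this, Iso.hom_inv_id_apply]
  rfl

lemma smul_restrict_fromSpec {U : X.Opens} (hU : IsAffineOpen U)
    (V : (Spec Γ(X, U)).Opens) (h : hU.fromSpec ''ᵁ V ≤ U) (r : Γ(X, U))
    (s : Γ(M.restrict hU.fromSpec, V)) :
    r • s = (resRing h r • (show Γ(M, hU.fromSpec ''ᵁ V) from s) : Γ(M, hU.fromSpec ''ᵁ V)) := by
  rw [← appIso_fromSpec_inv_apply hU V h r]
  rfl

/-- For an affine open `U`, sections of `M` over basic opens of `U` are localizations
of the sections over `U`. -/
def IsLocalizingOn (M : X.Modules) (U : X.Opens) : Prop :=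
  (∀ (f : Γ(X, U)) (s : Γ(M, X.basicOpen f)), ∃ (n : ℕ) (t : Γ(M, U)),
    res M (X.basicOpen_le f) t = resRing (X.basicOpen_le f) f ^ n • s) ∧
  ∀ (f : Γ(X, U)) (t : Γ(M, U)), res M (X.basicOpen_le f) t = 0 → ∃ n : ℕ, f ^ n • t = 0

/-- Only two of the three axioms of a localization remain, because `f` always acts invertibly on
sections over `D(f)`. The open `V` is a variable with an equation so that it can later be matched
with a basic open of `X`. -/
lemma isLocalizing_iff {R : CommRingCat.{u}} (N : (Spec R).Modules) :
    IsLocalizing (modulesSpecToSheaf.obj N) ↔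
    (∀ (f : R) (V : (Spec R).Opens) (_ : V = PrimeSpectrum.basicOpen f) (s : Γ(N, V)),
      ∃ (n : ℕ) (t : Γ(N, ⊤)), res N le_top t = f ^ n • s) ∧
    ∀ (f : R) (V : (Spec R).Opens) (_ : V = PrimeSpectrum.basicOpen f) (t : Γ(N, ⊤)),
      res N (le_top : V ≤ ⊤) t = 0 → ∃ n : ℕ, f ^ n • t = 0 := by
  let φ (f : R) := ((modulesSpecToSheaf.obj N).obj.map (PrimeSpectrum.basicOpen f).leTop.op).hom
  refine ⟨fun h => ?_, fun h f => IsLocalizedModule.Away.mk_of_addCommGroup ?_ ?_ ?_⟩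
  · have hf (f : R) : IsLocalizedModule.Away f (φ f) := h f
    refine ⟨fun f V hV s => ?_, fun f V hV s hs => ?_⟩
    · subst hV
      obtain ⟨n, y, hy⟩ := (hf f).surj _ _ s
      exact ⟨n, y, hy.symm⟩
    · subst hV
      obtain ⟨⟨_, n, rfl⟩, hn⟩ := (IsLocalizedModule.eq_zero_iff (.powers f) (φ f)).mp hs
      exact ⟨n, hn⟩
  · exact Scheme.Modules.isUnit_algebraMap_end_of_le_basicOpen f le_rfl
  · intro x
    obtain ⟨n, t, ht⟩ := h.1 _ _ rfl x
    exact ⟨n, t, ht.symm⟩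
  · intro x hx
    obtain ⟨n, hn⟩ := h.2 _ _ rfl _ hx
    exact ⟨n, hn⟩

/-- Sections of the restriction of `M` to the spectrum of an affine open. -/
def restrictFromSpecEquiv (M : X.Modules) {U : X.Opens} (hU : IsAffineOpen U)
    {V : (Spec Γ(X, U)).Opens} {W : X.Opens} (h : hU.fromSpec ''ᵁ V = W) :
    Γ(M.restrict hU.fromSpec, V) ≃+ Γ(M, W) :=
  AddEquiv.ofBijective (show Γ(M, hU.fromSpec ''ᵁ V) →+ Γ(M, W) from res M h.ge)
    ⟨res_injective_of_le h.ge h.le, fun s => ⟨res M h.le s, by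
      change res M _ (res M _ s) = s
      rw [res_res, res_self]⟩⟩

lemma restrictFromSpecEquiv_smul {U : X.Opens} (hU : IsAffineOpen U)
    {V : (Spec Γ(X, U)).Opens} {W : X.Opens} (h : hU.fromSpec ''ᵁ V = W) (hW : W ≤ U)
    (r : Γ(X, U)) (s : Γ(M.restrict hU.fromSpec, V)) :
    restrictFromSpecEquiv M hU h (r • s) = resRing hW r • restrictFromSpecEquiv M hU h s := by
  refine (congrArg (res M h.ge) (smul_restrict_fromSpec hU V (h.le.trans hW) r s)).trans ?_
  rw [res_smul, resRing_resRing]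
  rfl

lemma restrictFromSpecEquiv_res {U : X.Opens} (hU : IsAffineOpen U)
    {V V' : (Spec Γ(X, U)).Opens} {W W' : X.Opens} (h : hU.fromSpec ''ᵁ V = W)
    (h' : hU.fromSpec ''ᵁ V' = W') (k : V' ≤ V) (k' : W' ≤ W)
    (s : Γ(M.restrict hU.fromSpec, V)) :
    restrictFromSpecEquiv M hU h' (res _ k s) = res M k' (restrictFromSpecEquiv M hU h s) :=
  (res_res (Scheme.Hom.image_mono hU.fromSpec k) h'.ge _).trans (res_res h.ge k' _).symm

lemma isLocalizing_restrict_iff {U : X.Opens} (hU : IsAffineOpen U) :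
    IsLocalizing (modulesSpecToSheaf.obj (M.restrict hU.fromSpec)) ↔ IsLocalizingOn M U := by
  have hT : hU.fromSpec ''ᵁ ⊤ = U := by simp
  have hD {f : Γ(X, U)} {V : (Spec Γ(X, U)).Opens} (hV : V = PrimeSpectrum.basicOpen f) :
      hU.fromSpec ''ᵁ V = X.basicOpen f := by
    subst hV
    exact hU.fromSpec_image_basicOpen f
  let e := restrictFromSpecEquiv M hU hT
  rw [isLocalizing_iff]
  constructor
  · refine fun H => ⟨fun f s => ?_, fun f t ht => ?_⟩
    · obtain ⟨V, hV⟩ : ∃ V : (Spec Γ(X, U)).Opens, V = PrimeSpectrum.basicOpen f := ⟨_, rfl⟩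
      let e' := restrictFromSpecEquiv M hU (hD hV)
      obtain ⟨n, t, ht⟩ := H.1 f V hV (e'.symm s)
      refine ⟨n, e t, ?_⟩
      rw [← restrictFromSpecEquiv_res hU hT (hD hV) le_top, ht,
        restrictFromSpecEquiv_smul hU _ (X.basicOpen_le f), e'.apply_symm_apply, map_pow]
    · let e' := restrictFromSpecEquiv M hU (hD (f := f) rfl)
      obtain ⟨n, hn⟩ := H.2 f _ rfl (e.symm t) (e'.injective (by
        rw [restrictFromSpecEquiv_res hU hT (hD rfl) le_top (X.basicOpen_le f),
          e.apply_symm_apply, ht, map_zero]))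
      refine ⟨n, ?_⟩
      have := congrArg e hn
      rwa [restrictFromSpecEquiv_smul hU _ le_rfl, e.apply_symm_apply, resRing_self,
        map_zero] at this
  · refine fun H => ⟨fun f V hV s => ?_, fun f V hV t ht => ?_⟩
    · let e' := restrictFromSpecEquiv M hU (hD hV)
      obtain ⟨n, t, ht⟩ := H.1 f (e' s)
      refine ⟨n, e.symm t, e'.injective ?_⟩
      rw [restrictFromSpecEquiv_res hU hT (hD hV) le_top (X.basicOpen_le f), e.apply_symm_apply,
        ht, restrictFromSpecEquiv_smul hU _ (X.basicOpen_le f), map_pow]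
    · obtain ⟨n, hn⟩ := H.2 f (e t) (by
        rw [← restrictFromSpecEquiv_res hU hT (hD hV) le_top, ht, map_zero])
      refine ⟨n, e.injective ?_⟩
      rw [restrictFromSpecEquiv_smul hU _ le_rfl, resRing_self, hn, map_zero]

/-- On an affine scheme a quasi-coherent sheaf is the tilde of its global sections, and this is
equivalent to being localizing. -/
lemma isLocalizingOn_of_isQuasicoherent (hM : M.IsQuasicoherent) {U : X.Opens}
    (hU : IsAffineOpen U) : IsLocalizingOn M U := by
  rw [← isLocalizing_restrict_iff hU, ← isIso_fromTildeΓ_iff_isLocalizing]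
  infer_instance

/-- A presentation of the restriction of `M` to `U` as a presentation over the slice site. -/
def presentationOver {U : X.Opens}
    (p : SheafOfModules.Presentation.{u} (M.restrict U.ι)) :
    SheafOfModules.Presentation.{u} (SheafOfModules.over.{u} M U) :=
  let e := Scheme.Modules.overEquiv U
  let η : SheafOfModules.unit.{u} _ ≅ e.inverse.obj (SheafOfModules.unit _) :=
    e.unitIso.app (SheafOfModules.unit _) ≪≫
      e.inverse.mapIso (show e.functor.obj (SheafOfModules.unit _) ≅ _ from
        (Scheme.Modules.overFunctorEquiv U).app (SheafOfModules.unit X.ringCatSheaf) ≪≫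
          Scheme.Modules.restrictUnitIso U.ι)
  let i : e.inverse.obj (M.restrict U.ι) ≅ SheafOfModules.over.{u} M U :=
    e.inverse.mapIso ((Scheme.Modules.overFunctorEquiv U).symm.app M) ≪≫
      (e.unitIso.app _).symm
  let G : SheafOfModules.{u} (U : Scheme.{u}).ringCatSheaf ⥤
    SheafOfModules.{u} (X.ringCatSheaf.over U) := e.inverse
  have : G.IsEquivalence := inferInstanceAs e.inverse.IsEquivalence
  have : Limits.PreservesColimitsOfSize.{u, u} G := inferInstance
  let f : G.obj (M.restrict U.ι) ⟶ SheafOfModules.over.{u} M U := i.hom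
  have : IsIso f := inferInstanceAs (IsIso i.hom)
  (SheafOfModules.Presentation.map.{u} p G η).ofIsIso f

/-- Quasi-coherence is local, so a presentation over each `U i` suffices. The localizing condition
identifies the restriction with a tilde sheaf, whose presentation is carried from the spectrum to `U
i` and then to the slice site. -/
lemma isQuasicoherent_of_isLocalizingOn {ι : Type u} (U : ι → X.Opens)
    (hU : ∀ i, IsAffineOpen (U i)) (hcov : ∀ x : X, ∃ i, x ∈ U i)
    (h : ∀ i, IsLocalizingOn M (U i)) : M.IsQuasicoherent := by
  have (i : ι) : SheafOfModules.IsQuasicoherent.{u} (SheafOfModules.over.{u} M (U i)) := by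
    have hi := (isLocalizing_restrict_iff (hU i)).2 (h i)
    rw [← isIso_fromTildeΓ_iff_isLocalizing] at hi
    -- All global sections serve as generators and all relations among them as relations.
    let p := presentationTilde ((modulesSpecToSheaf.obj
      (M.restrict (hU i).fromSpec)).presheaf.obj (.op ⊤)) .univ (by simp) _ (Submodule.span_eq _)
    let N : SheafOfModules.{u} (Spec Γ(X, U i)).ringCatSheaf := M.restrict (hU i).fromSpec
    let T : SheafOfModules.{u} (Spec Γ(X, U i)).ringCatSheaf := tilde
      ((modulesSpecToSheaf.obj (M.restrict (hU i).fromSpec)).presheaf.obj (.op ⊤))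
    let f : T ⟶ N := (M.restrict (hU i).fromSpec).fromTildeΓ
    have hf : IsIso f := hi
    let p' : N.Presentation := p.ofIsIso f
    let c := (Scheme.Modules.restrictFunctorComp (hU i).isoSpec.hom (hU i).fromSpec).symm ≪≫
      Scheme.Modules.restrictFunctorCongr (hU i).isoSpec_hom_fromSpec
    let N' : SheafOfModules.{u} (U i : Scheme.{u}).ringCatSheaf := M.restrict (U i).ι
    let T' : SheafOfModules.{u} (U i : Scheme.{u}).ringCatSheaf :=
      (M.restrict (hU i).fromSpec).restrict (hU i).isoSpec.hom
    let q : T'.Presentation := Scheme.Modules.presentationRestrict (hU i).isoSpec.hom p'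
    let g : T' ⟶ N' := (c.app M).hom
    have hg : IsIso g := inferInstanceAs (IsIso (c.app M).hom)
    exact (presentationOver (q.ofIsIso g)).isQuasicoherent
  refine SheafOfModules.IsQuasicoherent.of_coversTop.{u} M U ?_
  rw [Opens.coversTop_iff]
  exact eq_top_iff.2 fun x _ => by simpa using hcov x

end

/-! ### Finiteness over affine opens. -/

section

variable {X : Scheme.{u}} {M : X.Modules}

lemma isUnit_resRing_basicOpen {U : X.Opens} (f : Γ(X, U)) :
    IsUnit (resRing (X.basicOpen_le f) f) :=
  RingedSpace.isUnit_res_basicOpen X.toRingedSpace f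

lemma exists_pow_mul_eq_resRing {U : X.Opens} (hU : IsAffineOpen U) (f : Γ(X, U))
    (r : Γ(X, X.basicOpen f)) : ∃ (n : ℕ) (a : Γ(X, U)),
      resRing (X.basicOpen_le f) f ^ n * r = resRing (X.basicOpen_le f) a := by
  have := hU.isLocalization_basicOpen f
  obtain ⟨⟨a, ⟨_, n, rfl⟩⟩, ha⟩ := IsLocalization.surj (Submonoid.powers f) r
  refine ⟨n, a, ?_⟩
  rw [mul_comm, ← map_pow]
  exact ha

/-- Generators over `U` restrict to generators over `D(f)`, since the denominators `f ^ n` are units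
there. -/
lemma finite_basicOpen {U : X.Opens} (h : IsLocalizingOn M U) [Module.Finite Γ(X, U) Γ(M, U)]
    (f : Γ(X, U)) : Module.Finite Γ(X, X.basicOpen f) Γ(M, X.basicOpen f) := by
  obtain ⟨S, hS⟩ := Module.Finite.fg_top (R := Γ(X, U)) (M := Γ(M, U))
  classical
  refine ⟨S.image (res M (X.basicOpen_le f)), eq_top_iff.2 fun s _ => ?_⟩
  obtain ⟨n, t, ht⟩ := h.1 f s
  have key (t : Γ(M, U)) : res M (X.basicOpen_le f) t ∈ Submodule.span Γ(X, X.basicOpen f)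
      (S.image (res M (X.basicOpen_le f)) : Set Γ(M, X.basicOpen f)) := by
    have ht' : t ∈ Submodule.span Γ(X, U) (S : Set Γ(M, U)) := hS ▸ Submodule.mem_top
    induction ht' using Submodule.span_induction with
    | mem x hx => exact Submodule.subset_span (by simpa using ⟨x, hx, rfl⟩)
    | zero => rw [map_zero]; exact zero_mem _
    | add x y _ _ hx hy =>
      rw [map_add]
      exact add_mem hx hy
    | smul a x _ hx =>
      rw [res_smul]
      exact Submodule.smul_mem _ _ hx
  have hmem := key t
  rw [ht] at hmem
  obtain ⟨v, hv⟩ := (isUnit_resRing_basicOpen f).pow n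
  rw [← hv] at hmem
  have := Submodule.smul_mem _ (↑v⁻¹ : Γ(X, X.basicOpen f)) hmem
  rwa [smul_smul, Units.inv_mul, one_smul] at this

lemma finite_of_basicOpen {U : X.Opens} (hU : IsAffineOpen U) (h : IsLocalizingOn M U)
    (t : Finset Γ(X, U)) (ht : Ideal.span (t : Set Γ(X, U)) = ⊤)
    (hf : ∀ f : t, Module.Finite Γ(X, X.basicOpen f.1) Γ(M, X.basicOpen f.1)) :
    Module.Finite Γ(X, U) Γ(M, U) := by
  have hloc (f : t) := hU.isLocalization_basicOpen f.1
  let (f : t) : Module Γ(X, U) Γ(M, X.basicOpen f.1) :=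
    Module.compHom _ (resRing (X.basicOpen_le f.1))
  have (f : t) : IsScalarTower Γ(X, U) Γ(X, X.basicOpen f.1) Γ(M, X.basicOpen f.1) :=
    ⟨fun a b m => by
      change (resRing (X.basicOpen_le f.1) a * b) • m = resRing (X.basicOpen_le f.1) a • (b • m)
      rw [mul_smul]⟩
  let ρ (f : t) : Γ(M, U) →ₗ[Γ(X, U)] Γ(M, X.basicOpen f.1) :=
    { res M (X.basicOpen_le f.1) with
      map_smul' := fun a m => res_smul _ a m }
  have (f : t) : IsLocalizedModule.Away f.1 (ρ f) := by
    refine IsLocalizedModule.Away.mk_of_addCommGroup ?_ ?_ ?_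
    · have h1 := (isUnit_resRing_basicOpen f.1).map
        (algebraMap _ (Module.End Γ(X, X.basicOpen f.1) Γ(M, X.basicOpen f.1)))
      rw [Module.End.isUnit_iff] at h1 ⊢
      exact h1
    · intro s
      obtain ⟨n, t, ht⟩ := h.1 f.1 s
      refine ⟨n, t, ?_⟩
      rw [← map_pow] at ht
      exact ht.symm
    · exact fun s hs => h.2 f.1 s hs
  exact Module.Finite.of_localizationSpan_finite' t ht ρ hf

/-- Coherence asks for finiteness on every affine open, while on `Y` it is directly accessible only
on preimages of affine opens of `X`. The two preceding lemmas are what the affine communication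
lemma needs. -/
lemma finite_of_affine_cover (hM : M.IsQuasicoherent) {ι : Type*} (U : ι → X.Opens)
    (hU : ∀ i, IsAffineOpen (U i)) (hcov : ∀ x : X, ∃ i, x ∈ U i)
    (h : ∀ i, Module.Finite Γ(X, U i) Γ(M, U i)) {V : X.Opens} (hV : IsAffineOpen V) :
    Module.Finite Γ(X, V) Γ(M, V) := by
  refine of_affine_open_cover (P := fun V => Module.Finite Γ(X, V.1) Γ(M, V.1))
    (fun i => ⟨U i, hU i⟩) (eq_top_iff.2 fun x _ => by simpa using hcov x) ⟨V, hV⟩ ?_ ?_ h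
  · intro U f hf
    exact finite_basicOpen (isLocalizingOn_of_isQuasicoherent hM U.2) f
  · intro U t ht hf
    exact finite_of_basicOpen U.2 (isLocalizingOn_of_isQuasicoherent hM U.2) t ht hf

/-! ### Torsion-free quasi-coherent sheaves on integral schemes -/

lemma resRing_ne_zero [IsIntegral X] {U V : X.Opens} (h : V ≤ U) (hV : (V : Set X).Nonempty)
    {a : Γ(X, U)} (ha : a ≠ 0) : resRing h a ≠ 0 :=
  (map_ne_zero_iff _ (resRing_injective h hV)).2 ha

lemma inf_nonempty [IsIntegral X] {U V : X.Opens} (hU : (U : Set X).Nonempty)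
    (hV : (V : Set X).Nonempty) : ((U ⊓ V : X.Opens) : Set X).Nonempty :=
  nonempty_preirreducible_inter U.2 V.2 hU hV

lemma ne_zero_of_basicOpen_nonempty {U : X.Opens} {f : Γ(X, U)}
    (h : (X.basicOpen f : Set X).Nonempty) : f ≠ 0 := by
  rintro rfl
  simp at h

lemma exists_isAffineOpen_le {U : X.Opens} {x : X} (hx : x ∈ U) :
    ∃ W : X.Opens, IsAffineOpen W ∧ x ∈ W ∧ W ≤ U := by
  obtain ⟨_, ⟨W, hW, rfl⟩, hxW, hWU⟩ := X.isBasis_affineOpens.exists_subset_of_mem_open hx U.2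
  exact ⟨W, hW, hxW, hWU⟩

/-- On an affine `W`, the open `V` contains some nonempty `D(f)`. A section vanishing there is
killed by a power of `f ≠ 0`, so torsion-freeness makes it zero on `W`. -/
lemma res_injective [IsIntegral X] (hM : M.IsQuasicoherent) (htf : IsTorsionFree M)
    {U V : X.Opens} (h : V ≤ U) (hV : (V : Set X).Nonempty) : Function.Injective (res M h) := by
  rw [injective_iff_map_eq_zero]
  intro s hs
  refine eq_of_locally_eq fun x hx => ?_
  obtain ⟨W, hW, hxW, hWU⟩ := exists_isAffineOpen_le hx
  refine ⟨W, hWU, hxW, ?_⟩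
  rw [map_zero]
  obtain ⟨y, hyV, hyW⟩ := inf_nonempty hV ⟨x, hxW⟩
  obtain ⟨f, hf, hyf⟩ := IsAffineOpen.exists_basicOpen_le hW ⟨y, hyV⟩ hyW
  obtain ⟨n, hn⟩ := (isLocalizingOn_of_isQuasicoherent hM hW).2 f (res M hWU s) (by
    rw [res_res, ← res_res h hf, hs, map_zero])
  exact (htf _ _ _ hn).resolve_left (pow_ne_zero n (by
    have : Nonempty W := ⟨⟨x, hxW⟩⟩
    exact ne_zero_of_basicOpen_nonempty ⟨y, hyf⟩))

end

section

/-! ### Subsheaves of modules -/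

section Subsheaf

variable {Y : Scheme.{u}} {G : Y.Modules}

/-- Membership in the submodule `N` is a local condition. -/
def IsLocalSubmodule (N : PresheafOfModules.Submodule G.val) : Prop :=
  ∀ (U : Y.Opens) (s : Γ(G, U)), (∀ y ∈ U, ∃ (V : Y.Opens) (h : V ≤ U), y ∈ V ∧
    res G h s ∈ N.obj (op V)) → s ∈ N.obj (op U)

/-- The sheaf condition may be tested on underlying sets, where a subfunctor of a sheaf is a sheaf
exactly when membership is local. -/
lemma IsLocalSubmodule.isSheaf {N : PresheafOfModules.Submodule G.val} (hN : IsLocalSubmodule N) :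
    TopCat.Presheaf.IsSheaf N.toPresheafOfModules.presheaf := by
  let P := G.val.presheaf
  have hM : Presheaf.IsSheaf (Opens.grothendieckTopology Y) P := G.isSheaf
  let S : Subfunctor (P ⋙ forget Ab) :=
    { obj := fun U => {s | s ∈ N.obj U}
      map := fun f _ hs => N.map f hs }
  rw [TopCat.Presheaf.IsSheaf, Presheaf.isSheaf_iff_isSheaf_forget _ _ (forget Ab)]
  rw [Presheaf.isSheaf_iff_isSheaf_forget _ _ (forget Ab), isSheaf_iff_isSheaf_of_type] at hM
  rw [isSheaf_iff_isSheaf_of_type]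
  have hS : Presieve.IsSheaf (Opens.grothendieckTopology Y) S.toFunctor := by
    rw [Subfunctor.isSheaf_iff _ hM]
    intro U s hs
    refine hN U.unop s fun y hy => ?_
    obtain ⟨W, i, hi, hyW⟩ := hs y hy
    exact ⟨W, i.le, hyW, hi⟩
  exact Presieve.isSheaf_iso _ (NatIso.ofComponents (fun U => Iso.refl _) (fun _ => rfl)) hS

/-- The sheaf of modules given by a submodule with local membership. -/
def subsheaf (N : PresheafOfModules.Submodule G.val) (hN : IsLocalSubmodule N) : Y.Modules where
  val := N.toPresheafOfModules
  isSheaf := hN.isSheaf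

/-- The inclusion of a subsheaf of modules. -/
def subsheafι (N : PresheafOfModules.Submodule G.val) (hN : IsLocalSubmodule N) :
    subsheaf N hN ⟶ G where
  val := N.ι

lemma subsheafι_injective (N : PresheafOfModules.Submodule G.val) (hN : IsLocalSubmodule N)
    (U : Y.Opens) : Function.Injective ((subsheafι N hN).app U) :=
  fun _ _ h => Subtype.ext h

lemma subsheafι_mem (N : PresheafOfModules.Submodule G.val) (hN : IsLocalSubmodule N)
    {U : Y.Opens} (s : Γ(subsheaf N hN, U)) : (subsheafι N hN).app U s ∈ N.obj (op U) :=
  s.2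

end Subsheaf

/-- A morphism of sheaves of modules from a family of linear maps compatible with restrictions. -/
def homMk {X : Scheme.{u}} {M N : X.Modules} (φ : ∀ U : X.Opens, Γ(M, U) →+ Γ(N, U))
    (hsmul : ∀ U (a : Γ(X, U)) (s : Γ(M, U)), φ U (a • s) = a • φ U s)
    (hres : ∀ {U V : X.Opens} (h : V ≤ U) (s : Γ(M, U)), φ V (res M h s) = res N h (φ U s)) :
    M ⟶ N where
  val := PresheafOfModules.homMk
    { app := fun U => AddCommGrpCat.ofHom (φ U.unop)
      naturality := fun U V f => by
        ext s
        exact hres (U := U.unop) (V := V.unop) f.unop.le s } fun U => hsmul U.unop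

/-! ### The subsheaf on `Y` generated by a sheaf on `X`; generation of the pullback. -/

section Generated

variable {X Y : Scheme.{u}} {ν : Y ⟶ X} {F : X.Modules} {G : Y.Modules}

variable (ν) in
/-- Pullback of functions. -/
def pullOn {U : X.Opens} {V : Y.Opens} (h : V ≤ ν ⁻¹ᵁ U) : Γ(X, U) →+* Γ(Y, V) :=
  (ν.appLE U V h).hom

lemma resRing_pullOn {U : X.Opens} {V W : Y.Opens} (h : V ≤ ν ⁻¹ᵁ U) (k : W ≤ V) (a : Γ(X, U)) :
    resRing k (pullOn ν h a) = pullOn ν (k.trans h) a := by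
  have := ν.appLE_map h (homOfLE k).op
  exact ConcreteCategory.congr_hom this a

lemma pullOn_resRing {U U' : X.Opens} {V : Y.Opens} (h : V ≤ ν ⁻¹ᵁ U') (k : U' ≤ U)
    (a : Γ(X, U)) :
    pullOn ν h (resRing k a) = pullOn ν (h.trans (ν.preimage_mono k)) a := by
  have := ν.map_appLE h (homOfLE k).op
  exact ConcreteCategory.congr_hom this a

/-- For `α : F ⟶ ν_* G` and `V ≤ ν⁻¹ U`, the image in `Γ(G, V)` of a section of `F` over `U`. -/
def secOn (α : F ⟶ (Scheme.Modules.pushforward ν).obj G) {U : X.Opens} {V : Y.Opens}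
    (h : V ≤ ν ⁻¹ᵁ U) : Γ(F, U) →+ Γ(G, V) :=
  (res G h).comp (show Γ(F, U) →+ Γ(G, ν ⁻¹ᵁ U) from (α.app U).hom)

variable (α : F ⟶ (Scheme.Modules.pushforward ν).obj G)

lemma secOn_preimage {U : X.Opens} (f : Γ(F, U)) :
    secOn α (le_refl (ν ⁻¹ᵁ U)) f = α.app U f :=
  res_self (M := G) (U := ν ⁻¹ᵁ U) _

lemma secOn_smul {U : X.Opens} {V : Y.Opens} (h : V ≤ ν ⁻¹ᵁ U) (a : Γ(X, U)) (f : Γ(F, U)) :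
    secOn α h (a • f) = pullOn ν h a • secOn α h f := by
  have h1 : α.app U (a • f) = ν.app U a • (show Γ(G, ν ⁻¹ᵁ U) from α.app U f) :=
    app_smul α a f
  change res G h (α.app U (a • f)) = _
  rw [h1, res_smul]
  rfl

lemma res_secOn {U : X.Opens} {V W : Y.Opens} (h : V ≤ ν ⁻¹ᵁ U) (k : W ≤ V) (f : Γ(F, U)) :
    res G k (secOn α h f) = secOn α (k.trans h) f :=
  res_res h k _

lemma secOn_res {U U' : X.Opens} {V : Y.Opens} (h : V ≤ ν ⁻¹ᵁ U') (k : U' ≤ U) (f : Γ(F, U)) :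
    secOn α h (res F k f) = secOn α (h.trans (ν.preimage_mono k)) f := by
  have h1 : α.app U' (res F k f) = res G (ν.preimage_mono k) (α.app U f) := app_res α k f
  exact (congrArg (res G h) h1).trans (res_res _ h _)

lemma app_secOn {G' : Y.Modules} (β : G ⟶ G') {U : X.Opens} {V : Y.Opens} (h : V ≤ ν ⁻¹ᵁ U)
    (f : Γ(F, U)) :
    β.app V (secOn α h f) = secOn (α ≫ (Scheme.Modules.pushforward ν).map β) h f :=
  app_res β h _

/-- A section of `G` is locally generated by `F` if locally it is a linear combination of images
of sections of `F`. -/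
def IsLocallyGenerated {W : Y.Opens} (s : Γ(G, W)) : Prop :=
  ∀ y ∈ W, ∃ (U : X.Opens) (V : Y.Opens) (h : V ≤ W) (k : V ≤ ν ⁻¹ᵁ U), y ∈ V ∧
    res G h s ∈ Submodule.span Γ(Y, V) (Set.range (secOn α k))

variable {α} in
lemma res_mem_span {U : X.Opens} {V W : Y.Opens} (k : V ≤ ν ⁻¹ᵁ U) (h : W ≤ V) {s : Γ(G, V)}
    (hs : s ∈ Submodule.span Γ(Y, V) (Set.range (secOn α k))) :
    res G h s ∈ Submodule.span Γ(Y, W) (Set.range (secOn α (h.trans k))) := by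
  induction hs using Submodule.span_induction with
  | mem x hx =>
    obtain ⟨f, rfl⟩ := hx
    exact Submodule.subset_span ⟨f, (res_secOn α k h f).symm⟩
  | zero => rw [map_zero]; exact zero_mem _
  | add x y _ _ hx hy => rw [map_add]; exact add_mem hx hy
  | smul a x _ hx => rw [res_smul]; exact Submodule.smul_mem _ _ hx

variable {α} in
lemma mem_span_of_le {U U' : X.Opens} {V : Y.Opens} (k : V ≤ ν ⁻¹ᵁ U') (h : U' ≤ U) {s : Γ(G, V)}
    (hs : s ∈ Submodule.span Γ(Y, V) (Set.range (secOn α (k.trans (ν.preimage_mono h))))) :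
    s ∈ Submodule.span Γ(Y, V) (Set.range (secOn α k)) := by
  refine Submodule.span_mono ?_ hs
  rintro _ ⟨f, rfl⟩
  exact ⟨res F h f, secOn_res α k h f⟩

variable {α} in
/-- The open sets witnessing local generation may be shrunk. -/
lemma IsLocallyGenerated.exists_isAffineOpen {W : Y.Opens} {s : Γ(G, W)}
    (hs : IsLocallyGenerated α s) {y : Y} (hy : y ∈ W) {T : X.Opens} (hT : ν y ∈ T) :
    ∃ (U : X.Opens) (V : Y.Opens) (h : V ≤ W) (k : V ≤ ν ⁻¹ᵁ U), IsAffineOpen U ∧ U ≤ T ∧ y ∈ V ∧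
      res G h s ∈ Submodule.span Γ(Y, V) (Set.range (secOn α k)) := by
  obtain ⟨U, V, h, k, hyV, hV⟩ := hs y hy
  obtain ⟨U', hU', hyU', hUU'⟩ :=
    exists_isAffineOpen_le (show ν y ∈ U ⊓ T from ⟨k hyV, hT⟩)
  refine ⟨U', V ⊓ ν ⁻¹ᵁ U', inf_le_left.trans h, inf_le_right, hU', hUU'.trans inf_le_right,
    ⟨hyV, hyU'⟩, mem_span_of_le _ (hUU'.trans inf_le_left) ?_⟩
  rw [← res_res h inf_le_left]
  exact res_mem_span k _ hV

variable {α} in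
lemma IsLocallyGenerated.add {W : Y.Opens} {s t : Γ(G, W)} (hs : IsLocallyGenerated α s)
    (ht : IsLocallyGenerated α t) : IsLocallyGenerated α (s + t) := by
  intro y hy
  obtain ⟨U₁, V₁, h₁, k₁, hy₁, hs₁⟩ := hs y hy
  -- Choosing `U` inside `U₁` places both summands in a span of sections of `F` over the same open
  -- set.
  obtain ⟨U, V₂, h₂, k₂, -, hU, hy₂, hs₂⟩ := ht.exists_isAffineOpen hy (k₁ hy₁)
  refine ⟨U, V₁ ⊓ V₂, inf_le_left.trans h₁, inf_le_right.trans k₂, ⟨hy₁, hy₂⟩, ?_⟩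
  rw [map_add]
  refine add_mem (mem_span_of_le _ hU ?_) ?_
  · rw [← res_res h₁ inf_le_left]
    exact res_mem_span k₁ _ hs₁
  · rw [← res_res h₂ inf_le_right]
    exact res_mem_span k₂ _ hs₂

lemma IsLocallyGenerated.zero {W : Y.Opens} : IsLocallyGenerated α (0 : Γ(G, W)) :=
  fun y hy => ⟨⊤, W, le_rfl, le_top, hy, by rw [map_zero]; exact zero_mem _⟩

variable {α} in
lemma IsLocallyGenerated.smul {W : Y.Opens} (b : Γ(Y, W)) {s : Γ(G, W)}
    (hs : IsLocallyGenerated α s) : IsLocallyGenerated α (b • s) := by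
  intro y hy
  obtain ⟨U, V, h, k, hyV, hV⟩ := hs y hy
  refine ⟨U, V, h, k, hyV, ?_⟩
  rw [res_smul]
  exact Submodule.smul_mem _ _ hV

variable {α} in
lemma IsLocallyGenerated.res {W W' : Y.Opens} (j : W' ≤ W) {s : Γ(G, W)}
    (hs : IsLocallyGenerated α s) : IsLocallyGenerated α (res G j s) := by
  intro y hy
  obtain ⟨U, V, h, k, hyV, hV⟩ := hs y (j hy)
  refine ⟨U, V ⊓ W', inf_le_right, inf_le_left.trans k, ⟨hyV, hy⟩, ?_⟩
  have := res_mem_span k (inf_le_left : V ⊓ W' ≤ V) hV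
  rw [res_res] at this ⊢
  exact this

/-- The subsheaf of `G` generated by the image of `F`, as a submodule. -/
def generatedSubmodule : PresheafOfModules.Submodule G.val where
  obj W :=
    { carrier := {s | IsLocallyGenerated α (W := W.unop) s}
      add_mem' := fun hs ht => hs.add ht
      zero_mem' := IsLocallyGenerated.zero α (W := W.unop)
      smul_mem' := fun b _ hs => IsLocallyGenerated.smul (W := W.unop) b hs }
  map {W W'} f := fun _ hs => IsLocallyGenerated.res (W := W.unop) (W' := W'.unop) f.unop.le hs

lemma generatedSubmodule_isLocal : IsLocalSubmodule (generatedSubmodule α) := by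
  intro W s hs y hy
  obtain ⟨V, h, hyV, hV⟩ := hs y hy
  obtain ⟨U, V', h', k, hy', hV'⟩ := hV y hyV
  rw [res_res] at hV'
  exact ⟨U, V', h'.trans h, k, hy', hV'⟩

lemma isLocallyGenerated_secOn {U : X.Opens} {V : Y.Opens} (h : V ≤ ν ⁻¹ᵁ U) (f : Γ(F, U)) :
    IsLocallyGenerated α (secOn α h f) := fun y hy =>
  ⟨U, V, le_rfl, h, hy, by rw [res_self]; exact Submodule.subset_span ⟨f, rfl⟩⟩

/-- The subsheaf of `G` generated by the image of `F`. -/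
def generatedSubsheaf : Y.Modules :=
  subsheaf (generatedSubmodule α) (generatedSubmodule_isLocal α)

/-- The inclusion of the subsheaf generated by the image of `F`. -/
def generatedι : generatedSubsheaf α ⟶ G :=
  subsheafι (generatedSubmodule α) (generatedSubmodule_isLocal α)

lemma generatedι_injective (U : Y.Opens) : Function.Injective ((generatedι α).app U) :=
  subsheafι_injective _ _ U

lemma isLocallyGenerated_generatedι {U : Y.Opens} (s : Γ(generatedSubsheaf α, U)) :
    IsLocallyGenerated α ((generatedι α).app U s) :=
  subsheafι_mem _ (generatedSubmodule_isLocal α) s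

/-- A morphism to a pushforward from a compatible family of semilinear maps. -/
def homToPushforward (φ : ∀ U : X.Opens, Γ(F, U) →+ Γ(G, ν ⁻¹ᵁ U))
    (hsmul : ∀ U (a : Γ(X, U)) (f : Γ(F, U)), φ U (a • f) = pullOn ν le_rfl a • φ U f)
    (hres : ∀ {U V : X.Opens} (h : V ≤ U) (f : Γ(F, U)),
      φ V (res F h f) = res G (ν.preimage_mono h) (φ U f)) :
    F ⟶ (Scheme.Modules.pushforward ν).obj G :=
  homMk φ (fun U a f => (hsmul U a f).trans (by
    have : pullOn ν (le_refl (ν ⁻¹ᵁ U)) a = ν.app U a := by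
      rw [Scheme.Hom.app_eq_appLE]; rfl
    rw [this]; rfl)) hres

variable {α} in
lemma hom_ext_secOn {β : F ⟶ (Scheme.Modules.pushforward ν).obj G}
    (h : ∀ (U : X.Opens) (f : Γ(F, U)), secOn α (le_refl (ν ⁻¹ᵁ U)) f = secOn β le_rfl f) :
    α = β := by
  refine Scheme.Modules.hom_ext _ _ fun U => ?_
  ext f
  exact (secOn_preimage α f).symm.trans ((h U f).trans (secOn_preimage β f))

/-- The image of a section of `F` in the subsheaf generated by the image of `F`. -/
def genSec (U : X.Opens) : Γ(F, U) →+ Γ(generatedSubsheaf α, ν ⁻¹ᵁ U) where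
  toFun f := ⟨secOn α (le_refl (ν ⁻¹ᵁ U)) f, isLocallyGenerated_secOn α _ f⟩
  map_zero' := Subtype.ext (map_zero _)
  map_add' s t := Subtype.ext (map_add _ s t)

lemma generatedι_genSec (U : X.Opens) (f : Γ(F, U)) :
    (generatedι α).app _ (genSec α U f) = secOn α (le_refl (ν ⁻¹ᵁ U)) f := rfl

/-- The map from `F` to the pushforward of the subsheaf generated by its image. -/
def toGenerated : F ⟶ (Scheme.Modules.pushforward ν).obj (generatedSubsheaf α) :=
  homToPushforward (genSec α)
    (fun U a f => generatedι_injective α _ (by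
      rw [app_smul, generatedι_genSec, generatedι_genSec, secOn_smul]))
    (fun h f => generatedι_injective α _ (by
      rw [app_res, generatedι_genSec, generatedι_genSec, res_secOn, secOn_res]))

lemma secOn_toGenerated {U : X.Opens} {V : Y.Opens} (h : V ≤ ν ⁻¹ᵁ U) (f : Γ(F, U)) :
    secOn (toGenerated α) h f = res _ h (genSec α U f) := rfl

lemma toGenerated_ι :
    toGenerated α ≫ (Scheme.Modules.pushforward ν).map (generatedι α) = α := by
  refine hom_ext_secOn fun U f => ?_
  rw [← app_secOn, secOn_toGenerated, res_self, generatedι_genSec]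

lemma generatedι_secOn {U : X.Opens} {V : Y.Opens} (h : V ≤ ν ⁻¹ᵁ U) (f : Γ(F, U)) :
    (generatedι α).app V (secOn (toGenerated α) h f) = secOn α h f := by
  rw [app_secOn, toGenerated_ι]

/-- If the unit factors through `R.map i`, then `i` is a split epimorphism. For the inclusion `i` of
the subsheaf generated by `F`, this forces that subsheaf to be the whole pullback. -/
lemma homEquiv_symm_comp_eq_id {C D : Type*} [Category* C] [Category* D] {L : C ⥤ D} {R : D ⥤ C}
    (adj : L ⊣ R) {F : C} {Q : D} {t : F ⟶ R.obj Q} {i : Q ⟶ L.obj F}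
    (h : t ≫ R.map i = adj.unit.app F) : (adj.homEquiv F Q).symm t ≫ i = 𝟙 _ := by
  apply (adj.homEquiv _ _).injective
  rw [Adjunction.homEquiv_naturality_right, Equiv.apply_symm_apply, h, Adjunction.homEquiv_id]

variable (ν F) in
/-- The unit of the pullback-pushforward adjunction. -/
def unitHom : F ⟶ (Scheme.Modules.pushforward ν).obj ((Scheme.Modules.pullback ν).obj F) :=
  (Scheme.Modules.pullbackPushforwardAdjunction ν).unit.app F

/-- The morphism from the pullback adjoint to a morphism to the pushforward. -/
def adjointHom : (Scheme.Modules.pullback ν).obj F ⟶ G :=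
  ((Scheme.Modules.pullbackPushforwardAdjunction ν).homEquiv F G).symm α

lemma unitHom_adjointHom :
    unitHom ν F ≫ (Scheme.Modules.pushforward ν).map (adjointHom α) = α := by
  have := (Scheme.Modules.pullbackPushforwardAdjunction ν).homEquiv_unit (f := adjointHom α)
  rw [adjointHom, Equiv.apply_symm_apply] at this
  exact this.symm

lemma adjointHom_secOn {U : X.Opens} {V : Y.Opens} (h : V ≤ ν ⁻¹ᵁ U) (f : Γ(F, U)) :
    (adjointHom α).app V (secOn (unitHom ν F) h f) = secOn α h f := by
  rw [app_secOn, unitHom_adjointHom]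

/-- Sections of a pullback are locally generated by the sections of the original sheaf. -/
lemma isLocallyGenerated_unitHom {W : Y.Opens} (s : Γ((Scheme.Modules.pullback ν).obj F, W)) :
    IsLocallyGenerated (unitHom ν F) s := by
  -- This is the section of the inclusion of the generated subsheaf, adjoint to the factorization of
  -- the unit.
  let r := adjointHom (toGenerated (unitHom ν F))
  have hr : r ≫ generatedι (unitHom ν F) = 𝟙 _ :=
    homEquiv_symm_comp_eq_id (Scheme.Modules.pullbackPushforwardAdjunction ν)
      (toGenerated_ι (unitHom ν F))
  have h1 : (generatedι (unitHom ν F)).app W (r.app W s) = s := by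
    have := congrArg (fun φ => Scheme.Modules.Hom.app φ W s) hr
    exact this
  rw [← h1]
  exact isLocallyGenerated_generatedι _ _

end Generated

end

/-! ### Comparing functions on `X` and `Y` through the birational locus. -/

section

lemma IsNormalization.exists_section {X Y : Scheme.{u}} {ν : Y ⟶ X} (hν : IsNormalization ν) :
    ∃ (U : X.Opens) (k : (U : Scheme.{u}) ⟶ Y), (U : Set X).Nonempty ∧ IsOpenImmersion k ∧
      k ≫ ν = U.ι := by
  obtain ⟨U, hU, hiso⟩ := hν.birational
  refine ⟨U, inv (ν ∣_ U) ≫ (ν ⁻¹ᵁ U).ι, hU, inferInstance, ?_⟩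
  rw [Category.assoc, ← morphismRestrict_ι, IsIso.inv_hom_id_assoc]

section OpenImmersion

variable {X Y Z : Scheme.{u}}

lemma pullOn_pullOn (k : Z ⟶ Y) (ν : Y ⟶ X) (j : Z ⟶ X) (hk : k ≫ ν = j) {U : X.Opens}
    {V : Y.Opens} {W : Z.Opens} (h : V ≤ ν ⁻¹ᵁ U) (l : W ≤ k ⁻¹ᵁ V) (m : W ≤ j ⁻¹ᵁ U)
    (a : Γ(X, U)) : pullOn k l (pullOn ν h a) = pullOn j m a := by
  subst hk
  exact ConcreteCategory.congr_hom (Scheme.Hom.appLE_comp_appLE k ν U V W h l) a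

variable (j : Z ⟶ X) [IsOpenImmersion j]

lemma pullOn_image_bijective {W : Z.Opens} (h : W ≤ j ⁻¹ᵁ (j ''ᵁ W)) :
    Function.Bijective (pullOn j h) := by
  have := ConcreteCategory.bijective_of_isIso (j.appIso W).hom
  rwa [Scheme.Hom.appIso_hom'] at this

lemma image_nonempty {W : Z.Opens} (hW : (W : Set Z).Nonempty) :
    ((j ''ᵁ W : X.Opens) : Set X).Nonempty := by
  obtain ⟨z, hz⟩ := hW
  exact ⟨j z, z, hz, rfl⟩

lemma pullOn_injective_of_isOpenImmersion [IsIntegral X] {U : X.Opens} {W : Z.Opens}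
    (h : W ≤ j ⁻¹ᵁ U) (hW : (W : Set Z).Nonempty) : Function.Injective (pullOn j h) := by
  have hle : j ''ᵁ W ≤ U := by rintro _ ⟨z, hz, rfl⟩; exact h hz
  have hW' : W ≤ j ⁻¹ᵁ (j ''ᵁ W) := (j.preimage_image_eq W).ge
  intro a b hab
  rw [← pullOn_resRing hW' hle, ← pullOn_resRing hW' hle] at hab
  exact resRing_injective hle (image_nonempty j hW) ((pullOn_image_bijective j hW').1 hab)

lemma exists_pullOn_eq {D : X.Opens} {W : Z.Opens} (h : W ≤ j ⁻¹ᵁ D) (hD : D ≤ j ''ᵁ W)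
    (r : Γ(Z, W)) : ∃ a, pullOn j h a = r := by
  have hW' : W ≤ j ⁻¹ᵁ (j ''ᵁ W) := (j.preimage_image_eq W).ge
  obtain ⟨b, hb⟩ := (pullOn_image_bijective j hW').2 r
  exact ⟨resRing hD b, by rw [pullOn_resRing, hb]⟩

end OpenImmersion

variable {X Y : Scheme.{u}} {ν : Y ⟶ X} [IsIntegral Y] {U₀ : X.Opens}
  {k : (U₀ : Scheme.{u}) ⟶ Y} [IsOpenImmersion k]

lemma preimage_nonempty (h₀ : (U₀ : Set X).Nonempty) {V : Y.Opens} (hV : (V : Set Y).Nonempty) :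
    ((k ⁻¹ᵁ V : (U₀ : Scheme.{u}).Opens) : Set (U₀ : Scheme.{u})).Nonempty := by
  obtain ⟨x, hx⟩ := h₀
  have hr : (k.opensRange : Set Y).Nonempty := ⟨k ⟨x, hx⟩, ⟨x, hx⟩, rfl⟩
  obtain ⟨_, ⟨z, rfl⟩, hz⟩ := inf_nonempty hr hV
  exact ⟨z, hz⟩

variable [IsIntegral X]

/-- Pulling back further along `k` turns `ν` into the open inclusion of `U₀`, and restriction of
functions to nonempty opens of an integral scheme is injective. -/
lemma pullOn_injective (hk : k ≫ ν = U₀.ι) (h₀ : (U₀ : Set X).Nonempty) {U : X.Opens}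
    {V : Y.Opens} (h : V ≤ ν ⁻¹ᵁ U) (hV : (V : Set Y).Nonempty) :
    Function.Injective (pullOn ν h) := by
  have hl : k ⁻¹ᵁ V ≤ U₀.ι ⁻¹ᵁ U := by
    rw [← hk]
    exact k.preimage_mono h
  intro a b hab
  apply pullOn_injective_of_isOpenImmersion U₀.ι hl (preimage_nonempty h₀ hV)
  rw [← pullOn_pullOn k ν U₀.ι hk h le_rfl hl, hab, pullOn_pullOn k ν U₀.ι hk h le_rfl hl]

/-- Functions on `Y` have denominators on `X`. -/
lemma exists_pullOn_mul_eq (hk : k ≫ ν = U₀.ι) (h₀ : (U₀ : Set X).Nonempty) {U : X.Opens}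
    (hU : IsAffineOpen U) {V : Y.Opens} (h : V ≤ ν ⁻¹ᵁ U) (hV : (V : Set Y).Nonempty)
    (r : Γ(Y, V)) : ∃ a b : Γ(X, U), a ≠ 0 ∧ pullOn ν h a * r = pullOn ν h b := by
  have hl : k ⁻¹ᵁ V ≤ U₀.ι ⁻¹ᵁ U := by
    rw [← hk]
    exact k.preimage_mono h
  obtain ⟨z, hz⟩ := preimage_nonempty (k := k) h₀ hV
  -- Over a basic open `D(f)` inside the image of `k⁻¹ V`, the function `r` becomes a function on
  -- `X`, that is `b / f ^ n`. Since `Y` is integral, the resulting identity may be checked after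
  -- pulling back to this open set.
  obtain ⟨f, hf, hzf⟩ := IsAffineOpen.exists_basicOpen_le hU
    (V := U₀.ι ''ᵁ (k ⁻¹ᵁ V)) (⟨U₀.ι z, z, hz, rfl⟩ : U₀.ι ''ᵁ (k ⁻¹ᵁ V)) (hl hz)
  have hne : Nonempty U := ⟨⟨_, hl hz⟩⟩
  have hW : U₀.ι ⁻¹ᵁ X.basicOpen f ≤ k ⁻¹ᵁ V := by
    intro w hw
    obtain ⟨w', hw', e⟩ := hf hw
    rwa [← U₀.ι.isOpenEmbedding.injective e]
  have hWne : ((U₀.ι ⁻¹ᵁ X.basicOpen f : (U₀ : Scheme.{u}).Opens) :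
    Set (U₀ : Scheme.{u})).Nonempty := ⟨z, hzf⟩
  have hD : X.basicOpen f ≤ U₀.ι ''ᵁ (U₀.ι ⁻¹ᵁ X.basicOpen f) := by
    intro x hx
    obtain ⟨w, hw, rfl⟩ := hf hx
    exact ⟨w, hx, rfl⟩
  obtain ⟨r', hr'⟩ := exists_pullOn_eq U₀.ι le_rfl hD (pullOn k hW r)
  obtain ⟨n, b, hb⟩ := exists_pow_mul_eq_resRing hU f r'
  refine ⟨f ^ n, b, pow_ne_zero n (ne_zero_of_basicOpen_nonempty ⟨_, hzf⟩), ?_⟩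
  apply pullOn_injective_of_isOpenImmersion k hW hWne
  rw [map_mul, pullOn_pullOn k ν U₀.ι hk h hW (hW.trans hl),
    pullOn_pullOn k ν U₀.ι hk h hW (hW.trans hl), ← hr',
    ← pullOn_resRing le_rfl (X.basicOpen_le f), ← pullOn_resRing le_rfl (X.basicOpen_le f),
    ← map_mul, map_pow, hb]

end

/-! ### Recognizing the pullback modulo torsion. -/

section

section EpiKernel

variable {Y : Scheme.{u}}

lemma epi_of_locally_surjective {P G : Y.Modules} (π : P ⟶ G)
    (h : ∀ (W : Y.Opens) (s : Γ(G, W)), ∀ y ∈ W, ∃ (V : Y.Opens) (hV : V ≤ W), y ∈ V ∧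
      ∃ t, π.app V t = res G hV s) : Epi π := by
  refine ⟨fun g g' hg => Scheme.Modules.hom_ext _ _ fun W => ?_⟩
  ext s
  refine eq_of_locally_eq fun y hy => ?_
  obtain ⟨V, hV, hyV, t, ht⟩ := h W s y hy
  refine ⟨V, hV, hyV, ?_⟩
  rw [← app_res, ← app_res, ← ht]
  exact congrArg (fun φ => Scheme.Modules.Hom.app φ V t) hg

/-- An epimorphism whose kernel consists of the torsion sections identifies its target with the
quotient by the torsion subsheaf. -/
lemma nonempty_modTorsion_iso [IsIntegral Y] {P G : Y.Modules} (π : P ⟶ G) [Epi π]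
    (h : ∀ (W : Y.Opens) (s : Γ(P, W)), π.app W s = 0 ↔ IsLocallyTorsion P s) :
    Nonempty (modTorsion P ≅ G) := by
  have w : torsionι P ≫ π = 0 := by
    refine Scheme.Modules.hom_ext _ _ fun W => ?_
    ext s
    exact (h W _).2 s.2
  let lift {T : Y.Modules} (g : T ⟶ P) (hg : g ≫ π = 0) : T ⟶ torsionSubsheaf P :=
    homMk (fun W =>
      { toFun := fun s => ⟨g.app W s, (h W _).1
          (congrArg (fun φ => Scheme.Modules.Hom.app φ W s) hg)⟩
        map_zero' := Subtype.ext (map_zero _)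
        map_add' := fun s t => Subtype.ext (map_add _ s t) })
      (fun W a s => Subtype.ext (app_smul g a s)) (fun k s => Subtype.ext (app_res g k s))
  have hmono : Mono (torsionι P) := by
    refine ⟨fun g g' hg => Scheme.Modules.hom_ext _ _ fun W => ?_⟩
    ext s
    exact Subtype.ext (congrArg (fun φ => Scheme.Modules.Hom.app φ W s) hg)
  -- The torsion subsheaf is the kernel of `π`, and in an abelian category an epimorphism is the
  -- cokernel of its kernel.
  have hker : Limits.IsLimit (Limits.KernelFork.ofι (torsionι P) w) :=
    Limits.KernelFork.IsLimit.ofι _ _ lift (fun g hg => rfl)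
      (fun g hg m hm => by rw [← cancel_mono (torsionι P), hm]; rfl)
  exact ⟨(Limits.colimit.isColimit _).coconePointUniqueUpToIso
    (Abelian.epiIsCokernelOfKernel _ hker)⟩

end EpiKernel

variable {X Y : Scheme.{u}} {ν : Y ⟶ X} [IsIntegral Y] [IsIntegral X] {U₀ : X.Opens}
  {k : (U₀ : Scheme.{u}) ⟶ Y} [IsOpenImmersion k] {F : X.Modules} {G : Y.Modules}

/-- Linear combinations of sections of `F` become sections of `F` after multiplication by a
denominator. -/
lemma exists_smul_eq_secOn (hk : k ≫ ν = U₀.ι) (h₀ : (U₀ : Set X).Nonempty)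
    (α : F ⟶ (Scheme.Modules.pushforward ν).obj G) {U : X.Opens} (hU : IsAffineOpen U)
    {V : Y.Opens} (h : V ≤ ν ⁻¹ᵁ U) (hV : (V : Set Y).Nonempty) {t : Γ(G, V)}
    (ht : t ∈ Submodule.span Γ(Y, V) (Set.range (secOn α h))) :
    ∃ (a : Γ(X, U)) (f : Γ(F, U)), a ≠ 0 ∧ pullOn ν h a • t = secOn α h f := by
  have hne : Nonempty U := by
    obtain ⟨y, hy⟩ := hV
    exact ⟨⟨_, h hy⟩⟩
  induction ht using Submodule.span_induction with
  | mem x hx =>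
    obtain ⟨f, rfl⟩ := hx
    exact ⟨1, f, one_ne_zero, by rw [map_one, one_smul]⟩
  | zero => exact ⟨1, 0, one_ne_zero, by rw [map_zero, smul_zero]⟩
  | add x y _ _ hx hy =>
    obtain ⟨a, f, ha, haf⟩ := hx
    obtain ⟨b, g, hb, hbg⟩ := hy
    refine ⟨a * b, b • f + a • g, mul_ne_zero ha hb, ?_⟩
    rw [map_add, secOn_smul, secOn_smul, ← haf, ← hbg, smul_add, map_mul, smul_smul, smul_smul,
      mul_comm (pullOn ν h b)]
  | smul r x _ hx =>
    obtain ⟨a, f, ha, haf⟩ := hx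
    obtain ⟨b, c, hb, hbc⟩ := exists_pullOn_mul_eq hk h₀ hU h hV r
    refine ⟨b * a, c • f, mul_ne_zero hb ha, ?_⟩
    rw [secOn_smul, ← haf, smul_smul, smul_smul, map_mul, ← hbc]
    congr 1
    ring

/-- Generation makes the adjoint map `ν^* F ⟶ G` locally surjective. Torsion of `ν^* F` dies because
`G` is torsion-free. Conversely, locally `a • s` comes from a section `f` of `F`; if `s` maps to
zero then so does `f`, so `f = 0` by `hinj` and `a` kills `s`. -/
theorem nonempty_modTorsion_pullback_iso (hk : k ≫ ν = U₀.ι) (h₀ : (U₀ : Set X).Nonempty)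
    (α : F ⟶ (Scheme.Modules.pushforward ν).obj G)
    (hinj : ∀ (U : X.Opens) (V : Y.Opens) (h : V ≤ ν ⁻¹ᵁ U), IsAffineOpen U →
      (V : Set Y).Nonempty → Function.Injective (secOn α h))
    (hgen : ∀ (W : Y.Opens) (s : Γ(G, W)), IsLocallyGenerated α s) (htf : IsTorsionFree G) :
    Nonempty (modTorsion ((Scheme.Modules.pullback ν).obj F) ≅ G) := by
  have hepi : Epi (adjointHom α) := by
    refine epi_of_locally_surjective _ fun W s y hy => ?_
    obtain ⟨U, V, h, l, hyV, hV⟩ := hgen W s y hy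
    refine ⟨V, h, hyV, ?_⟩
    generalize res G h s = x at hV ⊢
    induction hV using Submodule.span_induction with
    | mem x hx =>
      obtain ⟨f, rfl⟩ := hx
      exact ⟨_, adjointHom_secOn α l f⟩
    | zero => exact ⟨0, map_zero _⟩
    | add x y _ _ hx hy =>
      obtain ⟨t, ht⟩ := hx
      obtain ⟨t', ht'⟩ := hy
      exact ⟨t + t', by rw [map_add, ht, ht']⟩
    | smul r x _ hx =>
      obtain ⟨t, ht⟩ := hx
      exact ⟨r • t, by rw [app_smul, ht]⟩
  refine nonempty_modTorsion_iso (adjointHom α) fun W s => ⟨fun hs y hy => ?_, fun hs => ?_⟩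
  · obtain ⟨U, V, h, l, hU, -, hyV, hV⟩ :=
      (isLocallyGenerated_unitHom s).exists_isAffineOpen hy (T := ⊤) trivial
    have hVne : (V : Set Y).Nonempty := ⟨y, hyV⟩
    obtain ⟨a, f, ha, haf⟩ := exists_smul_eq_secOn hk h₀ _ hU l hVne hV
    refine ⟨V, h, hyV, pullOn ν l a,
      (map_ne_zero_iff _ (pullOn_injective hk h₀ l hVne)).2 ha, ?_⟩
    have hf : f = 0 := by
      apply hinj U V l hU hVne
      rw [← adjointHom_secOn, ← haf, app_smul, app_res, hs, map_zero, smul_zero, map_zero]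
    rw [hf, map_zero] at haf
    exact haf
  · refine eq_of_locally_eq fun y hy => ?_
    obtain ⟨V, h, hyV, a, ha, has⟩ := hs y hy
    refine ⟨V, h, hyV, ?_⟩
    rw [map_zero]
    refine (htf V a _ ?_).resolve_left ha
    rw [← app_res, ← app_smul]
    exact (congrArg ((adjointHom α).app V) has).trans (map_zero _)

end

section

variable {X Y : Scheme.{u}} {ν : Y ⟶ X}

/-! ### Modules over the pushforward of the structure sheaf -/

section RingAction

variable (F : SheafOfModules.{u} (pushforwardRing ν))

/-- The action of functions on `ν⁻¹ U` on the sections over `U` of a `ν_* 𝒪_Y`-module. -/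
def topSmul {U : X.Opens} (b : Γ(Y, ν ⁻¹ᵁ U)) (f : Γ((restrictToBase ν).obj F, U)) :
    Γ((restrictToBase ν).obj F, U) :=
  show F.val.obj (op U) from (show (pushforwardRing ν).obj.obj (op U) from b) •
    (show F.val.obj (op U) from f)

lemma topSmul_mul {U : X.Opens} (b c : Γ(Y, ν ⁻¹ᵁ U)) (f : Γ((restrictToBase ν).obj F, U)) :
    topSmul F (b * c) f = topSmul F b (topSmul F c f) :=
  mul_smul (show (pushforwardRing ν).obj.obj (op U) from b)
    (show (pushforwardRing ν).obj.obj (op U) from c) (show F.val.obj (op U) from f)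

lemma topSmul_pullOn {U : X.Opens} (a : Γ(X, U)) (f : Γ((restrictToBase ν).obj F, U)) :
    topSmul F (pullOn ν le_rfl a) f = a • f := by
  have : pullOn ν (le_refl (ν ⁻¹ᵁ U)) a = ν.app U a := by
    rw [Scheme.Hom.app_eq_appLE]; rfl
  rw [this]
  rfl

lemma res_topSmul {U V : X.Opens} (h : V ≤ U) (b : Γ(Y, ν ⁻¹ᵁ U))
    (f : Γ((restrictToBase ν).obj F, U)) :
    res _ h (topSmul F b f) = topSmul F (resRing (ν.preimage_mono h) b) (res _ h f) :=
  F.val.map_smul (homOfLE h).op b f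

end RingAction

/-! ### Torsion-free sheaves generated by a sheaf on the base -/

/-- `G` is torsion-free and generated by `F` through the morphism `α`, which is injective. -/
structure IsTorsionFreeHull {F : X.Modules} {G : Y.Modules}
    (α : F ⟶ (Scheme.Modules.pushforward ν).obj G) : Prop where
  isTorsionFree : IsTorsionFree G
  res_injective : ∀ {U V : Y.Opens} (h : V ≤ U), (V : Set Y).Nonempty →
    Function.Injective (res G h)
  secOn_injective : ∀ (U : X.Opens) (V : Y.Opens) (h : V ≤ ν ⁻¹ᵁ U), IsAffineOpen U →
    (V : Set Y).Nonempty → Function.Injective (secOn α h)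
  isLocallyGenerated : ∀ (W : Y.Opens) (s : Γ(G, W)), IsLocallyGenerated α s

/-- A prime containing `I` but not `g` would be a point of `D(g)` at which every element of `I`
vanishes. -/
lemma mem_radical_of_basicOpen {V : Y.Opens} (hV : IsAffineOpen V) (I : Ideal Γ(Y, V))
    (g : Γ(Y, V)) (h : ∀ y ∈ Y.basicOpen g, ∃ b ∈ I, y ∈ Y.basicOpen b) : g ∈ I.radical := by
  rw [Ideal.radical_eq_sInf, Submodule.mem_sInf]
  rintro p ⟨hIp, hp⟩
  by_contra hgp
  let x : PrimeSpectrum Γ(Y, V) := ⟨p, hp⟩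
  have hx (b : Γ(Y, V)) : hV.fromSpec x ∈ Y.basicOpen b ↔ b ∉ p := by
    change x ∈ hV.fromSpec ⁻¹ᵁ Y.basicOpen b ↔ _
    rw [hV.fromSpec_preimage_basicOpen]
    rfl
  obtain ⟨b, hb, hxb⟩ := h _ ((hx g).2 hgp)
  exact (hx b).1 hxb (hIp hb)

variable [IsIntegral Y] [IsIntegral X] {U₀ : X.Opens} {k : (U₀ : Scheme.{u}) ⟶ Y}
  [IsOpenImmersion k] {F : SheafOfModules.{u} (pushforwardRing ν)} {G : Y.Modules}
  {α : (restrictToBase ν).obj F ⟶ (Scheme.Modules.pushforward ν).obj G}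

/-- A linear map over `𝒪_X` to a torsion-free sheaf is linear over `ν_* 𝒪_Y`. -/
lemma secOn_topSmul (hk : k ≫ ν = U₀.ι) (h₀ : (U₀ : Set X).Nonempty) (htf : IsTorsionFree G)
    {U : X.Opens} {V : Y.Opens} (h : V ≤ ν ⁻¹ᵁ U) (b : Γ(Y, ν ⁻¹ᵁ U))
    (f : Γ((restrictToBase ν).obj F, U)) :
    secOn α h (topSmul F b f) = resRing h b • secOn α h f := by
  have aux : secOn α le_rfl (topSmul F b f) = b • secOn α le_rfl f := by
    refine eq_of_locally_eq fun y hy => ?_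
    obtain ⟨U', hU', hyU', hle⟩ := exists_isAffineOpen_le (show ν y ∈ U from hy)
    refine ⟨ν ⁻¹ᵁ U', ν.preimage_mono hle, hyU', ?_⟩
    have hne : ((ν ⁻¹ᵁ U' : Y.Opens) : Set Y).Nonempty := ⟨y, hyU'⟩
    rw [res_smul, res_secOn, res_secOn, ← secOn_res α le_rfl hle, ← secOn_res α le_rfl hle,
      res_topSmul, ← sub_eq_zero]
    -- With `a * b = c` and `a`, `c` from `X`, linearity over `𝒪_X` shows that `a` kills the
    -- difference of the two sides; torsion-freeness then cancels `a`.
    obtain ⟨a, c, ha, hac⟩ := exists_pullOn_mul_eq hk h₀ hU' le_rfl hne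
      (resRing (ν.preimage_mono hle) b)
    refine (htf _ (pullOn ν le_rfl a) _ ?_).resolve_left
      ((map_ne_zero_iff _ (pullOn_injective hk h₀ le_rfl hne)).2 ha)
    rw [smul_sub, ← secOn_smul, ← topSmul_pullOn, ← topSmul_mul, smul_smul, hac, topSmul_pullOn,
      secOn_smul, sub_self]
  have := congrArg (res G h) aux
  rwa [res_smul, res_secOn, res_secOn] at this

/-- Near `y` the section is a combination of sections of `F` over some `D(a)` with coefficients on
`D(b)`. A power of `b` clears the denominators of both, and the coefficients are absorbed by the
action of `ν_* 𝒪_Y` on `F`. -/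
lemma exists_basicOpen_smul_eq_secOn (hF : ((restrictToBase ν).obj F).IsQuasicoherent)
    (hk : k ≫ ν = U₀.ι) (h₀ : (U₀ : Set X).Nonempty) (htf : IsTorsionFree G)
    {U : X.Opens} (hU : IsAffineOpen U) (hV : IsAffineOpen (ν ⁻¹ᵁ U)) {W : Y.Opens}
    (hW : W ≤ ν ⁻¹ᵁ U) {s : Γ(G, W)} (hs : IsLocallyGenerated α s) {y : Y} (hy : y ∈ W) :
    ∃ (b : Γ(Y, ν ⁻¹ᵁ U)) (h : Y.basicOpen b ≤ W) (n : ℕ) (f : Γ((restrictToBase ν).obj F, U)),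
      y ∈ Y.basicOpen b ∧ resRing (Y.basicOpen_le b) b ^ n • res G h s =
        secOn α (Y.basicOpen_le b) f := by
  obtain ⟨U', V, hVW, hVU', -, hU'U, hyV, hspan⟩ := hs.exists_isAffineOpen hy (hW hy)
  obtain ⟨a, haU', hya⟩ := IsAffineOpen.exists_basicOpen_le hU ⟨ν y, hVU' hyV⟩ (hW hy)
  obtain ⟨b, hbV, hyb⟩ := IsAffineOpen.exists_basicOpen_le hV
    (V := V ⊓ ν ⁻¹ᵁ (X.basicOpen a)) ⟨y, hyV, hya⟩ (hW hy)
  have hba : Y.basicOpen b ≤ ν ⁻¹ᵁ (X.basicOpen a) := hbV.trans inf_le_right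
  refine ⟨b, (hbV.trans inf_le_left).trans hVW, ?_⟩
  have hmem := mem_span_of_le hba haU' (res_mem_span hVU' (hbV.trans inf_le_left) hspan)
  rw [res_res] at hmem
  suffices ∃ (n : ℕ) (f : Γ((restrictToBase ν).obj F, U)), _ from
    let ⟨n, f, hf⟩ := this
    ⟨n, f, hyb, hf⟩
  generalize res G _ s = t at hmem ⊢
  induction hmem using Submodule.span_induction with
  | mem x hx =>
    obtain ⟨f, rfl⟩ := hx
    obtain ⟨m, f', hf'⟩ := (isLocalizingOn_of_isQuasicoherent hF hU).1 a f
    -- From `D(b) ⊆ D(a)` on `ν⁻¹ U` one gets `b ^ n = a * c`, so `b ^ (n * m) = a ^ m * c ^ m`. The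
    -- factor `a ^ m` extends `f` from `D(a)` to `U`.
    have hrad : b ∈ (Ideal.span {pullOn ν (le_refl (ν ⁻¹ᵁ U)) a}).radical := by
      refine mem_radical_of_basicOpen hV _ b fun z hz =>
        ⟨_, Ideal.subset_span (Set.mem_singleton _), ?_⟩
      have := hba hz
      rw [Scheme.preimage_basicOpen, Scheme.Hom.app_eq_appLE] at this
      exact this
    obtain ⟨n, hn⟩ := hrad
    obtain ⟨c, hc⟩ := Ideal.mem_span_singleton.1 hn
    refine ⟨n * m, topSmul F (c ^ m) f', ?_⟩
    rw [secOn_topSmul hk h₀ htf, ← secOn_res α hba (X.basicOpen_le a), hf', secOn_smul, smul_smul,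
      map_pow (pullOn ν hba), pullOn_resRing, pow_mul, ← map_pow, hc, map_mul, mul_pow,
      resRing_pullOn, map_pow, mul_comm]
  | zero => exact ⟨0, 0, by rw [map_zero, smul_zero]⟩
  | add x z _ _ hx hz =>
    obtain ⟨n, f, hf⟩ := hx
    obtain ⟨m, g, hg⟩ := hz
    refine ⟨n + m, topSmul F (b ^ m) f + topSmul F (b ^ n) g, ?_⟩
    rw [map_add, secOn_topSmul hk h₀ htf, secOn_topSmul hk h₀ htf, ← hf, ← hg, smul_smul,
      smul_smul, map_pow, map_pow, smul_add, pow_add, mul_comm (_ ^ m)]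
  | smul r x _ hx =>
    obtain ⟨n, f, hf⟩ := hx
    obtain ⟨m, c, hc⟩ := exists_pow_mul_eq_resRing hV b r
    refine ⟨m + n, topSmul F c f, ?_⟩
    rw [secOn_topSmul hk h₀ htf, ← hf, ← hc, smul_smul, smul_smul, pow_add]
    congr 1
    ring

/-- Over `D(g) ⊆ ν⁻¹ U`, sections of `G` are sections of `F` up to powers of `g`. -/
lemma IsTorsionFreeHull.exists_pow_smul_eq_secOn (hα : IsTorsionFreeHull α)
    (hF : ((restrictToBase ν).obj F).IsQuasicoherent)
    (hk : k ≫ ν = U₀.ι) (h₀ : (U₀ : Set X).Nonempty)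
    {U : X.Opens} (hU : IsAffineOpen U) (hV : IsAffineOpen (ν ⁻¹ᵁ U)) (g : Γ(Y, ν ⁻¹ᵁ U))
    (s : Γ(G, Y.basicOpen g)) : ∃ (n : ℕ) (f : Γ((restrictToBase ν).obj F, U)),
      resRing (Y.basicOpen_le g) g ^ n • s = secOn α (Y.basicOpen_le g) f := by
  -- The multipliers taking `s` into `F` form an ideal because `F` is a `ν_* 𝒪_Y`-module and `α`
  -- respects that action. It remains to see that `g` lies in its radical, a question about points
  -- of `D(g)`.
  let I : Ideal Γ(Y, ν ⁻¹ᵁ U) :=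
    { carrier := {b | ∃ f, resRing (Y.basicOpen_le g) b • s = secOn α (Y.basicOpen_le g) f}
      zero_mem' := ⟨0, by rw [map_zero, map_zero, zero_smul]⟩
      add_mem' := by
        rintro b c ⟨f, hf⟩ ⟨f', hf'⟩
        exact ⟨f + f', by rw [map_add, map_add, add_smul, hf, hf']⟩
      smul_mem' := by
        rintro c b ⟨f, hf⟩
        refine ⟨topSmul F c f, ?_⟩
        rw [secOn_topSmul hk h₀ hα.isTorsionFree, ← hf, smul_smul, smul_eq_mul, map_mul] }
  have hg : g ∈ I.radical := by
    refine mem_radical_of_basicOpen hV I g fun y hy => ?_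
    obtain ⟨b, h, n, f, hyb, hf⟩ := exists_basicOpen_smul_eq_secOn hF hk h₀ hα.isTorsionFree hU hV
      (Y.basicOpen_le g) (hα.isLocallyGenerated _ s) hy
    -- The extra factor `b` makes the exponent positive even for `n = 0`, so that the basic open is
    -- still `D(b)`. Membership in `I` is checked over `D(b)`, as restriction there is injective.
    refine ⟨b ^ (n + 1), ⟨topSmul F b f, ?_⟩, ?_⟩
    · apply hα.res_injective h ⟨y, hyb⟩
      rw [res_smul, resRing_resRing, res_secOn, secOn_topSmul hk h₀ hα.isTorsionFree, ← hf,
        smul_smul, pow_succ', map_mul, map_pow]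
    · rwa [Scheme.basicOpen_pow _ _ (Nat.succ_pos n)]
  obtain ⟨n, f, hf⟩ := hg
  exact ⟨n, f, by rw [← hf, map_pow]⟩

end

/-! ### Pushforward and coherence of a hull. -/

section

lemma preimage_nonempty_of_section {X Y : Scheme.{u}} {ν : Y ⟶ X} [IsIntegral X] {U₀ : X.Opens}
    {k : (U₀ : Scheme.{u}) ⟶ Y} (hk : k ≫ ν = U₀.ι) (h₀ : (U₀ : Set X).Nonempty)
    {U : X.Opens} (hU : (U : Set X).Nonempty) : ((ν ⁻¹ᵁ U : Y.Opens) : Set Y).Nonempty := by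
  obtain ⟨x, hx₀, hx⟩ := inf_nonempty h₀ hU
  let z : (U₀ : Scheme.{u}) := ⟨x, hx₀⟩
  have hz : ν (k z) = U₀.ι z := by rw [← hk]; rfl
  exact ⟨k z, show ν (k z) ∈ U from hz ▸ hx⟩

variable {X Y : Scheme.{u}} {ν : Y ⟶ X} [IsIntegral X] {U₀ : X.Opens}
  {k : (U₀ : Scheme.{u}) ⟶ Y} {F : SheafOfModules.{u} (pushforwardRing ν)}
  {G : Y.Modules} {α : (restrictToBase ν).obj F ⟶ (Scheme.Modules.pushforward ν).obj G}

lemma IsTorsionFreeHull.secOn_preimage_injective (hα : IsTorsionFreeHull α)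
    (hk : k ≫ ν = U₀.ι) (h₀ : (U₀ : Set X).Nonempty) (U : X.Opens) :
    Function.Injective (secOn α (le_refl (ν ⁻¹ᵁ U))) := by
  rw [injective_iff_map_eq_zero]
  intro f hf
  refine eq_of_locally_eq fun x hx => ?_
  obtain ⟨U', hU', hxU', hle⟩ := exists_isAffineOpen_le hx
  refine ⟨U', hle, hxU', ?_⟩
  apply hα.secOn_injective U' _ le_rfl hU' (preimage_nonempty_of_section hk h₀ ⟨x, hxU'⟩)
  rw [secOn_res, ← res_secOn α le_rfl (ν.preimage_mono hle), hf, map_zero, map_zero, map_zero]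

variable [IsIntegral Y] [IsOpenImmersion k]

/-- This is `IsTorsionFreeHull.exists_pow_smul_eq_secOn` for `g = 1`, where the power disappears. -/
lemma IsTorsionFreeHull.secOn_surjective (hα : IsTorsionFreeHull α)
    (hF : ((restrictToBase ν).obj F).IsQuasicoherent)
    (hk : k ≫ ν = U₀.ι) (h₀ : (U₀ : Set X).Nonempty)
    {U : X.Opens} (hU : IsAffineOpen U) (hV : IsAffineOpen (ν ⁻¹ᵁ U)) :
    Function.Surjective (secOn α (le_refl (ν ⁻¹ᵁ U))) := by
  intro s
  have h1 : Y.basicOpen (1 : Γ(Y, ν ⁻¹ᵁ U)) = ν ⁻¹ᵁ U := Y.basicOpen_of_isUnit isUnit_one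
  obtain ⟨n, f, hf⟩ := hα.exists_pow_smul_eq_secOn hF hk h₀ hU hV 1 (res G h1.le s)
  refine ⟨f, res_injective_of_le h1.le h1.ge ?_⟩
  rw [res_secOn, ← hf, map_one, one_pow, one_smul]

lemma IsTorsionFreeHull.isLocalizingOn (hα : IsTorsionFreeHull α)
    (hF : ((restrictToBase ν).obj F).IsQuasicoherent)
    (hk : k ≫ ν = U₀.ι) (h₀ : (U₀ : Set X).Nonempty)
    {U : X.Opens} (hU : IsAffineOpen U) (hV : IsAffineOpen (ν ⁻¹ᵁ U)) :
    IsLocalizingOn G (ν ⁻¹ᵁ U) := by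
  refine ⟨fun g s => ?_, fun g t ht => ?_⟩
  · obtain ⟨n, f, hf⟩ := hα.exists_pow_smul_eq_secOn hF hk h₀ hU hV g s
    exact ⟨n, secOn α le_rfl f, by rw [hf, res_secOn]⟩
  -- Restriction to a nonempty `D(g)` is injective, so exponent `0` works; an empty `D(g)` means `g
  -- = 0`, and exponent `1` works.
  · by_cases hg : (Y.basicOpen g : Set Y).Nonempty
    · exact ⟨0, by rw [hα.res_injective _ hg (ht.trans (map_zero _).symm), smul_zero]⟩
    · have : g = 0 := by
        rw [← basicOpen_eq_bot_iff]
        exact TopologicalSpace.Opens.not_nonempty_iff_eq_bot _ |>.1 hg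
      exact ⟨1, by rw [this, pow_one, zero_smul]⟩

/-- The preimages of affine opens form an affine cover of `Y`. On each of them `F` surjects onto the
sections of `G`, so generators of `F` over `𝒪_X` also generate `G` over `𝒪_Y`. -/
lemma IsTorsionFreeHull.isCoherent [IsAffineHom ν] (hα : IsTorsionFreeHull α)
    (hF : IsCoherent ((restrictToBase ν).obj F))
    (hk : k ≫ ν = U₀.ι) (h₀ : (U₀ : Set X).Nonempty) : IsCoherent G := by
  have hcov (y : Y) : ∃ U : X.affineOpens, y ∈ ν ⁻¹ᵁ U.1 := by
    obtain ⟨U, hU, hyU, -⟩ := exists_isAffineOpen_le (show ν y ∈ (⊤ : X.Opens) from trivial)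
    exact ⟨⟨U, hU⟩, hyU⟩
  have hV (U : X.affineOpens) : IsAffineOpen (ν ⁻¹ᵁ U.1) := U.2.preimage ν
  have hqc : G.IsQuasicoherent :=
    isQuasicoherent_of_isLocalizingOn (fun U : X.affineOpens => ν ⁻¹ᵁ U.1) hV hcov
      fun U => hα.isLocalizingOn hF.isQuasicoherent hk h₀ U.2 (hV U)
  refine ⟨hqc, fun V hVaff => finite_of_affine_cover hqc _ hV hcov (fun U => ?_) hVaff⟩
  have := hF.finite U.1 U.2
  obtain ⟨S, hS⟩ := Module.Finite.fg_top (R := Γ(X, U.1)) (M := Γ((restrictToBase ν).obj F, U.1))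
  classical
  refine ⟨S.image (secOn α (le_refl (ν ⁻¹ᵁ U.1))), eq_top_iff.2 fun s _ => ?_⟩
  obtain ⟨f, rfl⟩ := hα.secOn_surjective hF.isQuasicoherent hk h₀ U.2 (hV U) s
  have hf : f ∈ Submodule.span Γ(X, U.1) (S : Set Γ((restrictToBase ν).obj F, U.1)) :=
    hS ▸ Submodule.mem_top
  induction hf using Submodule.span_induction with
  | mem x hx => exact Submodule.subset_span (by simpa using ⟨x, hx, rfl⟩)
  | zero => rw [map_zero]; exact zero_mem _
  | add x y _ _ hx hy => rw [map_add]; exact add_mem (hx trivial) (hy trivial)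
  | smul a x _ hx => rw [secOn_smul]; exact Submodule.smul_mem _ _ (hx trivial)

/-- Preimages exist over affine opens and, by injectivity, agree on overlaps; hence they glue over
any `U`. -/
lemma IsTorsionFreeHull.secOn_bijective [IsAffineHom ν] (hα : IsTorsionFreeHull α)
    (hF : ((restrictToBase ν).obj F).IsQuasicoherent)
    (hk : k ≫ ν = U₀.ι) (h₀ : (U₀ : Set X).Nonempty) (U : X.Opens) :
    Function.Bijective (secOn α (le_refl (ν ⁻¹ᵁ U))) := by
  refine ⟨hα.secOn_preimage_injective hk h₀ U, fun s => ?_⟩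
  let ι := { V : X.Opens // IsAffineOpen V ∧ V ≤ U }
  choose f hf using fun i : ι => hα.secOn_surjective hF hk h₀ i.2.1 (i.2.1.preimage ν)
    (res G (ν.preimage_mono i.2.2) s)
  obtain ⟨t, ht⟩ := existsUnique_gluing (M := (restrictToBase ν).obj F) (fun i : ι => i.1)
    (fun i => i.2.2) (fun x hx => by
      obtain ⟨V, hV, hxV, hVU⟩ := exists_isAffineOpen_le hx
      exact ⟨⟨V, hV, hVU⟩, hxV⟩) f (fun i j => by
      apply hα.secOn_preimage_injective hk h₀
      rw [secOn_res, secOn_res, ← res_secOn α le_rfl (ν.preimage_mono inf_le_left), hf,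
        ← res_secOn α le_rfl (ν.preimage_mono inf_le_right), hf, res_res, res_res])
  refine ⟨t, eq_of_locally_eq fun y hy => ?_⟩
  obtain ⟨V, hV, hyV, hVU⟩ := exists_isAffineOpen_le (show ν y ∈ U from hy)
  refine ⟨ν ⁻¹ᵁ V, ν.preimage_mono hVU, hyV, ?_⟩
  rw [res_secOn, ← secOn_res α le_rfl hVU, ht ⟨V, hV, hVU⟩, hf ⟨V, hV, hVU⟩]

lemma IsTorsionFreeHull.nonempty_pushforwardOverRing_iso [IsAffineHom ν] (hα : IsTorsionFreeHull α)
    (hF : ((restrictToBase ν).obj F).IsQuasicoherent)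
    (hk : k ≫ ν = U₀.ι) (h₀ : (U₀ : Set X).Nonempty) :
    Nonempty ((pushforwardOverRing ν).obj G ≅ F) := by
  let φ : F ⟶ (pushforwardOverRing ν).obj G :=
    { val := PresheafOfModules.homMk
        { app := fun U => AddCommGrpCat.ofHom (secOn α (le_refl (ν ⁻¹ᵁ U.unop)))
          naturality := fun U V f => by
            ext s
            exact (secOn_res (U := U.unop) (U' := V.unop) α le_rfl f.unop.le s).trans
              (res_secOn (U := U.unop) α le_rfl (ν.preimage_mono f.unop.le) s).symm }
        fun U b s => (secOn_topSmul (U := U.unop) hk h₀ hα.isTorsionFree le_rfl b s).trans (by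
          have := resRing_self (U := ν ⁻¹ᵁ U.unop) b
          exact congrArg (· • secOn α (le_refl (ν ⁻¹ᵁ U.unop)) s) this) }
  have : IsIso ((PresheafOfModules.toPresheaf _).map φ.val) := by
    refine (NatTrans.isIso_iff_isIso_app _).2 fun U => ?_
    rw [ConcreteCategory.isIso_iff_bijective]
    exact hα.secOn_bijective hF hk h₀ U.unop
  have : IsIso φ.val := isIso_of_reflects_iso φ.val (PresheafOfModules.toPresheaf _)
  have : IsIso ((SheafOfModules.forget _).map φ) := this
  have : IsIso φ := isIso_of_reflects_iso φ (SheafOfModules.forget _)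
  exact ⟨(asIso φ).symm⟩

end

section

variable {X Y : Scheme.{u}} {ν : Y ⟶ X} {U₀ : X.Opens}

/-! ### The hull generated inside the extension of the restriction to an open subset -/

section Ambient

variable (k : (U₀ : Scheme.{u}) ⟶ Y) (F : X.Modules)

/-- The extension to `Y` of the restriction of `F` to `U₀`. -/
def ambient : Y.Modules := (Scheme.Modules.pushforward k).obj (F.restrict U₀.ι)

/-- Sections of the ambient sheaf as sections of `F`. -/
def ambientEquiv (W : Y.Opens) : Γ(ambient k F, W) ≃+ Γ(F, U₀.ι ''ᵁ (k ⁻¹ᵁ W)) :=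
  AddEquiv.refl _

lemma ambientEquiv_res {V W : Y.Opens} (h : V ≤ W) (s : Γ(ambient k F, W)) :
    ambientEquiv k F V (res _ h s) =
      res F (Scheme.Hom.image_mono _ (k.preimage_mono h)) (ambientEquiv k F W s) := rfl

lemma ambientEquiv_smul {W : Y.Opens} (r : Γ(Y, W)) (c : Γ(X, U₀.ι ''ᵁ (k ⁻¹ᵁ W)))
    (hc : pullOn U₀.ι (U₀.ι.preimage_image_eq _).ge c = pullOn k le_rfl r)
    (s : Γ(ambient k F, W)) :
    ambientEquiv k F W (r • s) = c • ambientEquiv k F W s := by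
  have h1 : (U₀.ι.appIso (k ⁻¹ᵁ W)).hom c = k.app W r := by
    rw [Scheme.Hom.appIso_hom', Scheme.Hom.app_eq_appLE]
    exact hc
  have h2 : c = (U₀.ι.appIso (k ⁻¹ᵁ W)).inv (k.app W r) := by
    rw [← h1, Iso.hom_inv_id_apply]
  rw [h2]
  rfl

lemma image_preimage_le (hk : k ≫ ν = U₀.ι) {U : X.Opens} {V : Y.Opens} (h : V ≤ ν ⁻¹ᵁ U) :
    U₀.ι ''ᵁ (k ⁻¹ᵁ V) ≤ U := by
  rintro _ ⟨z, hz, rfl⟩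
  have : ν (k z) = U₀.ι z := by rw [← hk]; rfl
  exact this ▸ h hz

/-- The restriction map from `F` to the pushforward of the ambient sheaf. -/
def toAmbient (hk : k ≫ ν = U₀.ι) : F ⟶ (Scheme.Modules.pushforward ν).obj (ambient k F) :=
  homToPushforward
    (fun U => (ambientEquiv k F (ν ⁻¹ᵁ U)).symm.toAddMonoidHom.comp
      (res F (image_preimage_le k hk (le_refl (ν ⁻¹ᵁ U)))))
    (fun U a f => (ambientEquiv k F _).injective (by
      have hle := image_preimage_le k hk (le_refl (ν ⁻¹ᵁ U))
      rw [ambientEquiv_smul k F (pullOn ν le_rfl a) (resRing hle a) (by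
        rw [pullOn_resRing, pullOn_pullOn k ν U₀.ι hk le_rfl le_rfl])]
      exact res_smul hle a f))
    (fun h f => (ambientEquiv k F _).injective (by
      rw [ambientEquiv_res]
      exact (res_res h _ f).trans (res_res _ _ f).symm))

lemma ambientEquiv_secOn (hk : k ≫ ν = U₀.ι) {U : X.Opens} {V : Y.Opens} (h : V ≤ ν ⁻¹ᵁ U)
    (f : Γ(F, U)) :
    ambientEquiv k F V (secOn (toAmbient k F hk) h f) = res F (image_preimage_le k hk h) f :=
  res_res (image_preimage_le k hk (le_refl (ν ⁻¹ᵁ U)))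
    (Scheme.Hom.image_mono U₀.ι (k.preimage_mono h)) f

end Ambient

/-- Needed because the generated subsheaf is defined by combinations in the ambient sheaf, while a
hull must be generated by combinations taken in itself. -/
lemma exists_span_app_eq {F : X.Modules} {G G' : Y.Modules}
    (α : F ⟶ (Scheme.Modules.pushforward ν).obj G) (β : G ⟶ G') {α' : F ⟶ _}
    (hα' : α ≫ (Scheme.Modules.pushforward ν).map β = α')
    {U : X.Opens} {V : Y.Opens} (h : V ≤ ν ⁻¹ᵁ U) {x : Γ(G', V)}
    (hx : x ∈ Submodule.span Γ(Y, V) (Set.range (secOn α' h))) :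
    ∃ t ∈ Submodule.span Γ(Y, V) (Set.range (secOn α h)), β.app V t = x := by
  subst hα'
  induction hx using Submodule.span_induction with
  | mem x hx =>
    obtain ⟨f, rfl⟩ := hx
    exact ⟨_, Submodule.subset_span ⟨f, rfl⟩, app_secOn α β h f⟩
  | zero => exact ⟨0, zero_mem _, map_zero _⟩
  | add x y _ _ hx hy =>
    obtain ⟨t, ht, rfl⟩ := hx
    obtain ⟨t', ht', rfl⟩ := hy
    exact ⟨t + t', add_mem ht ht', map_add _ _ _⟩
  | smul r x _ hx =>
    obtain ⟨t, ht, rfl⟩ := hx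
    exact ⟨r • t, Submodule.smul_mem _ _ ht, app_smul _ _ _⟩

variable [IsIntegral Y] [IsIntegral X] {k : (U₀ : Scheme.{u}) ⟶ Y} [IsOpenImmersion k]

/-- Sections of the ambient sheaf are sections of `F` over opens of `U₀`, nonempty whenever the open
of `Y` is. So torsion-freeness and both injectivity conditions descend from `F`. -/
lemma isTorsionFreeHull_toGenerated {F : X.Modules} (hF : F.IsQuasicoherent)
    (htf : IsTorsionFree F) (hk : k ≫ ν = U₀.ι) (h₀ : (U₀ : Set X).Nonempty) :
    IsTorsionFreeHull (toGenerated (toAmbient k F hk)) := by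
  have hne {V : Y.Opens} (hV : (V : Set Y).Nonempty) :
      ((U₀.ι ''ᵁ (k ⁻¹ᵁ V) : X.Opens) : Set X).Nonempty :=
    image_nonempty _ (preimage_nonempty h₀ hV)
  constructor
  · intro W r s hrs
    by_cases hW : (W : Set Y).Nonempty
    · have h1 := congrArg ((generatedι (toAmbient k F hk)).app W) hrs
      rw [app_smul, map_zero] at h1
      obtain ⟨c, hc⟩ := (pullOn_image_bijective U₀.ι
        (U₀.ι.preimage_image_eq (k ⁻¹ᵁ W)).ge).2 (pullOn k le_rfl r)
      have h2 := congrArg (ambientEquiv k F W) h1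
      rw [ambientEquiv_smul k F r c hc, map_zero] at h2
      refine (htf _ _ _ h2).imp (fun h => ?_) (fun h => ?_)
      · rw [h, map_zero] at hc
        exact pullOn_injective_of_isOpenImmersion k le_rfl (preimage_nonempty h₀ hW)
          (hc.symm.trans (map_zero _).symm)
      · apply generatedι_injective
        apply (ambientEquiv k F W).injective
        rw [h, map_zero, map_zero]
    · right
      exact eq_of_locally_eq fun y hy => absurd ⟨y, hy⟩ hW
  · intro U V h hV s t hst
    have h1 := congrArg ((generatedι (toAmbient k F hk)).app V) hst
    rw [app_res, app_res] at h1
    have h2 := congrArg (ambientEquiv k F V) h1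
    rw [ambientEquiv_res, ambientEquiv_res] at h2
    exact generatedι_injective _ _
      ((ambientEquiv k F U).injective (res_injective hF htf _ (hne hV) h2))
  · intro U V h _ hV f g hfg
    have h1 := congrArg ((generatedι (toAmbient k F hk)).app V) hfg
    rw [generatedι_secOn, generatedι_secOn] at h1
    have h2 := congrArg (ambientEquiv k F V) h1
    rw [ambientEquiv_secOn, ambientEquiv_secOn] at h2
    exact res_injective hF htf _ (hne hV) h2
  · intro W s y hy
    obtain ⟨U, V, h, l, hyV, hV⟩ := isLocallyGenerated_generatedι (toAmbient k F hk) s y hy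
    refine ⟨U, V, h, l, hyV, ?_⟩
    obtain ⟨t, ht, e⟩ := exists_span_app_eq _ _ (toGenerated_ι (toAmbient k F hk)) l hV
    rw [← app_res] at e
    rwa [← generatedι_injective _ _ e]

/-- A quasi-coherent sheaf is the hull of its pushforward, if the latter is torsion-free. -/
lemma isTorsionFreeHull_of_iso [IsAffineHom ν] {F : X.Modules} {G : Y.Modules}
    (hG : G.IsQuasicoherent) (htf : IsTorsionFree F) (hk : k ≫ ν = U₀.ι)
    (h₀ : (U₀ : Set X).Nonempty) (α : F ⟶ (Scheme.Modules.pushforward ν).obj G) [IsIso α] :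
    IsTorsionFreeHull α := by
  have hsurj (U : X.Opens) : Function.Surjective (secOn α (le_refl (ν ⁻¹ᵁ U))) := fun s => by
    obtain ⟨f, hf⟩ := (ConcreteCategory.bijective_of_isIso (α.app U)).2 s
    exact ⟨f, (secOn_preimage α f).trans hf⟩
  have hinj (U : X.Opens) : Function.Injective (secOn α (le_refl (ν ⁻¹ᵁ U))) := fun f g hfg =>
    (ConcreteCategory.bijective_of_isIso (α.app U)).1
      ((secOn_preimage α f).symm.trans (hfg.trans (secOn_preimage α g)))
  have hloc {U : X.Opens} (hU : IsAffineOpen U) : IsLocalizingOn G (ν ⁻¹ᵁ U) :=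
    isLocalizingOn_of_isQuasicoherent hG (hU.preimage ν)
  -- A nonzero `b` has a nonzero multiple `c` coming from `X`, so torsion-freeness of `F` over `𝒪_X`
  -- lets `b` be cancelled.
  have hcancel {U : X.Opens} (hU : IsAffineOpen U) (hne : ((ν ⁻¹ᵁ U : Y.Opens) : Set Y).Nonempty)
      {b : Γ(Y, ν ⁻¹ᵁ U)} (hb : b ≠ 0) {f : Γ(F, U)} (hf : b • secOn α le_rfl f = 0) : f = 0 := by
    obtain ⟨a, c, ha, hac⟩ := exists_pullOn_mul_eq hk h₀ hU le_rfl hne b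
    have : Nonempty (ν ⁻¹ᵁ U : Y.Opens) := hne.to_subtype
    have hc : c ≠ 0 := by
      rintro rfl
      rw [map_zero] at hac
      exact mul_ne_zero ((map_ne_zero_iff _ (pullOn_injective hk h₀ le_rfl hne)).2 ha) hb hac
    refine (htf U c f (hinj U ?_)).resolve_left hc
    rw [secOn_smul, ← hac, mul_smul, hf, smul_zero, map_zero]
  have hpow {U : X.Opens} {g : Γ(Y, ν ⁻¹ᵁ U)} {y : Y} (hy : y ∈ Y.basicOpen g) (n : ℕ) :
      g ^ n ≠ 0 := by
    have : Nonempty (ν ⁻¹ᵁ U : Y.Opens) := ⟨⟨y, Y.basicOpen_le g hy⟩⟩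
    exact pow_ne_zero n (ne_zero_of_basicOpen_nonempty ⟨y, hy⟩)
  have hchart {W : Y.Opens} {y : Y} (hy : y ∈ W) : ∃ (U : X.Opens) (g : Γ(Y, ν ⁻¹ᵁ U)),
      IsAffineOpen U ∧ y ∈ Y.basicOpen g ∧ Y.basicOpen g ≤ W := by
    obtain ⟨U, hU, hyU, -⟩ := exists_isAffineOpen_le (show ν y ∈ (⊤ : X.Opens) from trivial)
    obtain ⟨g, hgW, hyg⟩ := IsAffineOpen.exists_basicOpen_le (hU.preimage ν) ⟨y, hy⟩ hyU
    exact ⟨U, g, hU, hyg, hgW⟩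
  have hunit {U : X.Opens} (g : Γ(Y, ν ⁻¹ᵁ U)) (n : ℕ) (t : Γ(G, Y.basicOpen g)) :
      ∃ v : Γ(Y, Y.basicOpen g), t = v • resRing (Y.basicOpen_le g) g ^ n • t := by
    obtain ⟨v, hv⟩ := (isUnit_resRing_basicOpen g).pow n
    exact ⟨(v⁻¹ : (Γ(Y, Y.basicOpen g))ˣ), by rw [← hv, smul_smul, Units.inv_mul, one_smul]⟩
  have htfG : IsTorsionFree G := by
    intro W r s hrs
    refine or_iff_not_imp_left.2 fun hr => eq_of_locally_eq fun y hy => ?_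
    obtain ⟨U, g, hU, hyg, hgW⟩ := hchart hy
    refine ⟨_, hgW, hyg, ?_⟩
    -- On the chart, `s = f / g ^ n` with `f` from `F` and `r = b / g ^ m`. Then `r • s = 0` gives
    -- `g ^ l * b • f = 0` over `ν⁻¹ U`, whence `f = 0`.
    obtain ⟨n, t, ht⟩ := (hloc hU).1 g (res G hgW s)
    obtain ⟨f, rfl⟩ := hsurj U t
    obtain ⟨m, b, hb⟩ := exists_pow_mul_eq_resRing (hU.preimage ν) g (resRing hgW r)
    obtain ⟨l, hl⟩ := (hloc hU).2 g (b • secOn α le_rfl f) (by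
      rw [res_smul, ht, ← hb, smul_smul, mul_right_comm, mul_smul, ← res_smul, hrs, map_zero,
        smul_zero])
    have hb0 : b ≠ 0 := by
      rintro rfl
      have : Nonempty (Y.basicOpen g) := ⟨⟨y, hyg⟩⟩
      rw [map_zero, ← map_pow] at hb
      exact mul_ne_zero (resRing_ne_zero _ ⟨y, hyg⟩ (hpow hyg m))
        (resRing_ne_zero _ ⟨y, hyg⟩ hr) hb
    have : Nonempty (ν ⁻¹ᵁ U : Y.Opens) := ⟨⟨y, Y.basicOpen_le g hyg⟩⟩
    have hf : f = 0 := hcancel hU ⟨y, Y.basicOpen_le g hyg⟩ (mul_ne_zero (hpow hyg l) hb0) (by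
      rw [mul_smul, hl])
    rw [hf, map_zero, map_zero] at ht
    obtain ⟨v, hv⟩ := hunit g n (res G hgW s)
    rw [hv, ← ht, smul_zero, map_zero]
  refine ⟨htfG, fun h hV => res_injective hG htfG h hV, fun U V h hU hV => ?_, fun W s y hy => ?_⟩
  · intro f f' hff
    rw [← res_secOn α le_rfl h, ← res_secOn α le_rfl h] at hff
    exact hinj U (res_injective hG htfG h hV hff)
  · obtain ⟨U, g, hU, hyg, hgW⟩ := hchart hy
    refine ⟨U, _, hgW, Y.basicOpen_le g, hyg, ?_⟩
    -- Here `s = f / g ^ n` again, and `g` is a unit on the chart, so `s` is a multiple of a single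
    -- section of `F`.
    obtain ⟨n, t, ht⟩ := (hloc hU).1 g (res G hgW s)
    obtain ⟨f, rfl⟩ := hsurj U t
    obtain ⟨v, hv⟩ := hunit g n (res G hgW s)
    rw [hv, ← ht, res_secOn]
    exact Submodule.smul_mem _ _ (Submodule.subset_span ⟨f, rfl⟩)

end

/-! ### Conclusion. -/

lemma IsCoherent.of_iso {X : Scheme.{u}} {M N : X.Modules} (e : M ≅ N) (hM : IsCoherent M) :
    IsCoherent N := by
  refine ⟨(SheafOfModules.isQuasicoherent X.ringCatSheaf).prop_of_iso (X := M) (Y := N) e hM.isQuasicoherent, fun U hU => ?_⟩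
  have := hM.finite U hU
  let f : Γ(M, U) →ₗ[Γ(X, U)] Γ(N, U) :=
    { toFun := e.hom.app U
      map_add' := map_add _
      map_smul' := app_smul e.hom }
  refine Module.Finite.of_surjective f fun s => ⟨e.inv.app U s, ?_⟩
  exact congrArg (fun φ => Scheme.Modules.Hom.app φ U s) e.inv_hom_id

end NormalizationModules

end

open NormalizationModules
theorem mainTheorem7 {X Xt : Scheme.{0}} [IsIntegral X] [IsIntegral Xt]
    (s : X ⟶ Spec (.of ℂ)) (hX : IsProjective s)
    (ν : Xt ⟶ X) (hν : IsNormalization ν) (hsmooth : Smooth (ν ≫ s))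
    (F : SheafOfModules.{0} (pushforwardRing ν))
    (hcoh : IsCoherent ((restrictToBase ν).obj F))
    (htf : IsTorsionFree ((restrictToBase ν).obj F)) :
    let E : Xt.Modules :=
      modTorsion ((Scheme.Modules.pullback ν).obj ((restrictToBase ν).obj F))
    IsCoherent E ∧ Nonempty ((pushforwardOverRing ν).obj E ≅ F) ∧
      ∀ E' : Xt.Modules, IsCoherent E' →
        Nonempty ((Scheme.Modules.pushforward ν).obj E' ≅ (restrictToBase ν).obj F) →
        Nonempty (E' ≅ E) := by
  intro E
  obtain ⟨U₀, k, h₀, _, hk⟩ := hν.exists_section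
  have := hν.isIntegralHom
  -- All hulls are isomorphic to `E`: the generated subsheaf gives coherence and the pushforward,
  -- and any competitor `E'` gives uniqueness.
  have hull {G : Xt.Modules}
      {α : (restrictToBase ν).obj F ⟶ (Scheme.Modules.pushforward ν).obj G}
      (hα : IsTorsionFreeHull α) : Nonempty (E ≅ G) :=
    nonempty_modTorsion_pullback_iso hk h₀ α hα.secOn_injective hα.isLocallyGenerated
      hα.isTorsionFree
  have hα := isTorsionFreeHull_toGenerated hcoh.isQuasicoherent htf hk h₀
  obtain ⟨e⟩ := hull hα
  obtain ⟨i⟩ := hα.nonempty_pushforwardOverRing_iso hcoh.isQuasicoherent hk h₀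
  refine ⟨(hα.isCoherent hcoh hk h₀).of_iso e.symm,
    ⟨(pushforwardOverRing ν).mapIso e ≪≫ i⟩, fun E' hE' ⟨j⟩ => ?_⟩
  obtain ⟨e'⟩ := hull (isTorsionFreeHull_of_iso hE'.isQuasicoherent htf hk h₀ j.inv)
  exact ⟨e'.symm⟩
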